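/- Proposition 3 (Random measurement gives covering). Let $A,B,R$ be finite-dimensional Hilbert spaces and let $|\psi\rangle_{ABR}$ be a unit vector in $A\otimes B\otimes R$, with reduced states $\rho_A,\rho_B,\rho_R$, such that $S(\rho_R)<S(\rho_B)$, where $S$ is the von Neumann entropy (logarithms to base $2$). Fix $\delta>0$. For $X\in\{A,B,R\}$ let $\rho_X=\sum_i p_i|i\rangle\langle i|$ be a spectral decomposition, call a sequence $i^n=i_1\cdots i_n$ typical if $p_{i^n}:=p_{i_1}\cdots p_{i_n}>0$ and $|-\log_2 p_{i^n}-nS(\rho_X)|\le n\delta$, let the typical subspace $\widetilde X\subset X^{\otimes n}$ be the span of the vectors $|i^n\rangle=|i_1\rangle\cdots|i_n\rangle$ with $i^n$ typical, and let $\Pi_{\widetilde X}$ be the orthogonal projector onto it. Put $$|\Omega\rangle_{\widetilde A\widetilde B\widetilde R}=(\Pi_{\widetilde A}\otimes\Pi_{\widetilde B}\otimes\Pi_{\widetilde R})|\psi\rangle^{\otimes n}_{ABR},\qquad |\Psi\rangle_{\widetilde A\widetilde B\widetilde R}=\frac{1}{\sqrt{\langle\Omega|\Omega\rangle}}|\Omega\rangle_{\widetilde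 A\widetilde B\widetilde R},$$ and let $\rho_{\widetilde R}=\operatorname{Tr}_{\widetilde A\widetilde B}|\Psi\rangle\langle\Psi|$. Let $\{|e_j\rangle\}_j$ be an orthonormal basis of $\widetilde A$ chosen at random according to the Haar measure on the unitary group of $\widetilde A$, let $p_j=\langle\Psi|(|e_j\rangle\langle e_j|\otimes I\otimes I)|\Psi\rangle$ be the probability of outcome $j$ when $\widetilde A$ is measured in this basis, and let $\rho^j_{\widetilde R}=\frac1{p_j}\operatorname{Tr}_{\widetilde B}|\varphi_j\rangle\langle\varphi_j|$ with $|\varphi_j\rangle=(\langle e_j|\otimes I\otimes I)|\Psi\rangle$ be the state of $\widetilde R$ given outcome $j$ (terms with $p_j=0$ count as $0$ below). Then for every $\epsilon>0$ and all large enough $n$, the vector $\Omega$ is nonzero (so that $\Psi$ is defined), the random variable $\sum_j p_j\|\rho^j_{\widetilde R}-\rho_{\widetilde R}\|_1$ is integrable, and $$\mathbb E\Bigl[\sum_j p_j\,\bigl\|\rho^j_{\widetilde R}-\rho_{\widetilde R}\bigr\|_1\Bigr]\le\epsilon,$$ where $\|X\|_1=\operatorname{Tr}\sqrt{X^\dagger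 X}$ and the expectation is over the choice of the basis. -/

import Mathlib

open MeasureTheory Filter
open scoped Kronecker

noncomputable section

namespace StateMerging

/-! ### Vectors, density matrices, partial traces -/

section Finite

variable {X Y : Type*}

/-- The squared Hilbert space norm `⟨v|v⟩` of a vector. -/
def normSq [Fintype X] (v : X → ℂ) : ℝ := ∑ x, ‖v x‖ ^ 2

/-- The rank-one operator `|v⟩⟨v|`. -/
def ketBra (v : X → ℂ) : Matrix X X ℂ := Matrix.vecMulVec v (star v)

/-- Partial trace over the left tensor factor. -/
def traceLeft [Fintype X] (M : Matrix (X × Y) (X × Y) ℂ) : Matrix Y Y ℂ :=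
  Matrix.of fun y y' => ∑ x, M (x, y) (x, y')

/-- Partial trace over the right tensor factor. -/
def traceRight [Fintype Y] (M : Matrix (X × Y) (X × Y) ℂ) : Matrix X X ℂ :=
  Matrix.of fun x x' => ∑ y, M (x, y) (x', y)

theorem isHermitian_ketBra (v : X → ℂ) : (ketBra v).IsHermitian := by
  ext x y
  simp [ketBra, Matrix.vecMulVec, mul_comm]

theorem isHermitian_traceLeft [Fintype X] {M : Matrix (X × Y) (X × Y) ℂ}
    (hM : M.IsHermitian) : (traceLeft M).IsHermitian := by
  ext y y'
  simp only [traceLeft, Matrix.conjTranspose_apply, Matrix.of_apply, star_sum]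
  exact Finset.sum_congr rfl fun x _ => hM.apply _ _

theorem isHermitian_traceRight [Fintype Y] {M : Matrix (X × Y) (X × Y) ℂ}
    (hM : M.IsHermitian) : (traceRight M).IsHermitian := by
  ext x x'
  simp only [traceRight, Matrix.conjTranspose_apply, Matrix.of_apply, star_sum]
  exact Finset.sum_congr rfl fun y _ => hM.apply _ _

/-- The trace norm `‖M‖₁ = Tr √(M† M)`, the sum of the square roots of the eigenvalues
of `M† M`. -/
def traceNorm [Fintype X] [DecidableEq X] (M : Matrix X X ℂ) : ℝ :=
  ∑ i, √((Matrix.isHermitian_conjTranspose_mul_self M).eigenvalues i)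

/-- The von Neumann entropy `S(ρ) = -∑ λ log₂ λ` (in bits) over the eigenvalues of `ρ`,
with the convention `0 log 0 = 0`. -/
def entropy [Fintype X] [DecidableEq X] {ρ : Matrix X X ℂ} (hρ : ρ.IsHermitian) : ℝ :=
  -∑ i, hρ.eigenvalues i * Real.logb 2 (hρ.eigenvalues i)

/-! ### Typical subspaces -/

/-- The eigenvalue `p_{i₁} ⋯ p_{iₙ}` of `ρ^{⊗n}` belonging to the sequence `i`. -/
def seqProb [Fintype X] [DecidableEq X] {ρ : Matrix X X ℂ} (hρ : ρ.IsHermitian)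
    {n : ℕ} (i : Fin n → X) : ℝ :=
  ∏ k, hρ.eigenvalues (i k)

/-- The eigenvector `|i₁⟩ ⊗ ⋯ ⊗ |iₙ⟩` of `ρ^{⊗n}`, where the `|i⟩` form an orthonormal
eigenbasis of `ρ`. The space `X^{⊗n}` consists of the functions on `Fin n → X`. -/
def seqVec [Fintype X] [DecidableEq X] {ρ : Matrix X X ℂ} (hρ : ρ.IsHermitian)
    {n : ℕ} (i : Fin n → X) : (Fin n → X) → ℂ :=
  fun x => ∏ k, hρ.eigenvectorBasis (i k) (x k)

open Classical in
/-- The `δ`-typical sequences: `|-log₂ p_i - n S(ρ)| ≤ n δ`. Sequences of probability zero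
(for which `-log₂ p_i = ∞`) are not typical. -/
def typicalSet [Fintype X] [DecidableEq X] {ρ : Matrix X X ℂ} (hρ : ρ.IsHermitian)
    (n : ℕ) (δ : ℝ) : Finset (Fin n → X) :=
  {i | 0 < seqProb hρ i ∧ |-Real.logb 2 (seqProb hρ i) - n * entropy hρ| ≤ n * δ}

/-- The typical projector: the orthogonal projector onto the typical subspace, which is the
span of the vectors `|i⟩` with `i` a typical sequence. -/
def typicalProj [Fintype X] [DecidableEq X] {ρ : Matrix X X ℂ} (hρ : ρ.IsHermitian)
    (n : ℕ) (δ : ℝ) : Matrix (Fin n → X) (Fin n → X) ℂ :=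
  ∑ i ∈ typicalSet hρ n δ, ketBra (seqVec hρ i)

/-! ### Haar measure on the unitary group -/

theorem isCompact_unitaryGroup (T : Type*) [Fintype T] [DecidableEq T] :
    IsCompact (Matrix.unitaryGroup T ℂ : Set (Matrix T T ℂ)) := by
  have hK : IsCompact (Set.univ.pi fun _ : T => Set.univ.pi fun _ : T =>
      Metric.closedBall (0 : ℂ) 1) :=
    isCompact_univ_pi fun _ => isCompact_univ_pi fun _ => isCompact_closedBall _ _
  refine IsCompact.of_isClosed_subset hK (isClosed_unitary (R := Matrix T T ℂ)) ?_
  intro U hU i _ j _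
  simpa using entry_norm_bound_of_unitary hU i j

instance instCompactSpaceUnitaryGroup (T : Type*) [Fintype T] [DecidableEq T] :
    CompactSpace (Matrix.unitaryGroup T ℂ) :=
  isCompact_iff_compactSpace.mp (isCompact_unitaryGroup T)

instance instMeasurableSpaceUnitaryGroup (T : Type*) [Fintype T] [DecidableEq T] :
    MeasurableSpace (Matrix.unitaryGroup T ℂ) := borel _

instance instBorelSpaceUnitaryGroup (T : Type*) [Fintype T] [DecidableEq T] :
    BorelSpace (Matrix.unitaryGroup T ℂ) := ⟨rfl⟩

/-- The Haar probability measure on the unitary group. -/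
def haarUnitary (T : Type*) [Fintype T] [DecidableEq T] :
    Measure (Matrix.unitaryGroup T ℂ) :=
  Measure.haarMeasure ⊤

end Finite

/-! ### A tripartite pure state and its typical part -/

section Tripartite

variable {A B R : Type*}

/-- The reduced state on `A` of the pure state `ψ` on `A ⊗ B ⊗ R`. -/
def reducedA [Fintype B] [Fintype R] (ψ : A × B × R → ℂ) : Matrix A A ℂ := traceRight (ketBra ψ)

/-- The reduced state on `B` of the pure state `ψ` on `A ⊗ B ⊗ R`. -/
def reducedB [Fintype A] [Fintype R] (ψ : A × B × R → ℂ) : Matrix B B ℂ := traceRight (traceLeft (ketBra ψ))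

/-- The reduced state on `R` of the pure state `ψ` on `A ⊗ B ⊗ R`. -/
def reducedR [Fintype A] [Fintype B] (ψ : A × B × R → ℂ) : Matrix R R ℂ := traceLeft (traceLeft (ketBra ψ))

theorem isHermitian_reducedA [Fintype B] [Fintype R] (ψ : A × B × R → ℂ) :
    (reducedA ψ).IsHermitian :=
  isHermitian_traceRight (isHermitian_ketBra ψ)

theorem isHermitian_reducedB [Fintype A] [Fintype R] (ψ : A × B × R → ℂ) :
    (reducedB ψ).IsHermitian :=
  isHermitian_traceRight (isHermitian_traceLeft (isHermitian_ketBra ψ))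

theorem isHermitian_reducedR [Fintype A] [Fintype B] (ψ : A × B × R → ℂ) :
    (reducedR ψ).IsHermitian :=
  isHermitian_traceLeft (isHermitian_traceLeft (isHermitian_ketBra ψ))

/-- The `n` copies `ψ^{⊗n}`, as a vector on `A^n ⊗ B^n ⊗ R^n`. -/
def copies (ψ : A × B × R → ℂ) (n : ℕ) : (Fin n → A) × (Fin n → B) × (Fin n → R) → ℂ :=
  fun x => ∏ k, ψ (x.1 k, x.2.1 k, x.2.2 k)

variable [Fintype A] [Fintype B] [Fintype R] [DecidableEq A] [DecidableEq B] [DecidableEq R]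

/-- The vector `Ω = (Π_A ⊗ Π_B ⊗ Π_R) ψ^{⊗n}` with the typical projectors of the three reduced
states of `ψ`. -/
def typicalPart (ψ : A × B × R → ℂ) (n : ℕ) (δ : ℝ) :
    (Fin n → A) × (Fin n → B) × (Fin n → R) → ℂ :=
  (typicalProj (isHermitian_reducedA ψ) n δ ⊗ₖ
    (typicalProj (isHermitian_reducedB ψ) n δ ⊗ₖ
      typicalProj (isHermitian_reducedR ψ) n δ)).mulVec (copies ψ n)

/-- The normalized state vector `Ψ = Ω / √⟨Ω|Ω⟩`. -/
def typicalState (ψ : A × B × R → ℂ) (n : ℕ) (δ : ℝ) :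
    (Fin n → A) × (Fin n → B) × (Fin n → R) → ℂ :=
  fun x => ((√(normSq (typicalPart ψ n δ)))⁻¹ : ℝ) * typicalPart ψ n δ x

/-! ### The measurement -/

/-- The unnormalized vector `(⟨e| ⊗ I ⊗ I) |Ψ⟩` on `B ⊗ R` that results from a measurement
outcome `|e⟩` on `A`. -/
def collapse (Ψ : A × B × R → ℂ) (e : A → ℂ) : B × R → ℂ :=
  fun y => ∑ a, star (e a) * Ψ (a, y)

/-- The probability `⟨Ψ| (|e⟩⟨e| ⊗ I ⊗ I) |Ψ⟩` of the outcome `|e⟩`. -/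
def outcomeProb (Ψ : A × B × R → ℂ) (e : A → ℂ) : ℝ := normSq (collapse Ψ e)

/-- The state of `R` after the outcome `|e⟩`. Outcomes of probability zero do not contribute
to any average over outcomes. -/
def postState (Ψ : A × B × R → ℂ) (e : A → ℂ) : Matrix R R ℂ :=
  (((outcomeProb Ψ e)⁻¹ : ℝ) : ℂ) • traceLeft (ketBra (collapse Ψ e))

/-- The orthonormal basis of the typical subspace of `A^n` obtained by rotating the basis of
typical sequences with the unitary `U`: its `j`-th element is `∑ i, U i j |i⟩`. -/
def rotatedBasis (ψ : A × B × R → ℂ) (n : ℕ) (δ : ℝ)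
    (U : Matrix.unitaryGroup (typicalSet (isHermitian_reducedA ψ) n δ) ℂ)
    (j : typicalSet (isHermitian_reducedA ψ) n δ) : (Fin n → A) → ℂ :=
  fun x => ∑ i : typicalSet (isHermitian_reducedA ψ) n δ,
    (U : Matrix _ _ ℂ) i j * seqVec (isHermitian_reducedA ψ) i.1 x

/-- The disturbance `∑ j, p_j ‖ρ^j_R - ρ_R‖₁` of the reference when the typical state `Ψ` is
measured on the typical subspace of `A^n` in the basis given by `U`. -/
def disturbance (ψ : A × B × R → ℂ) (n : ℕ) (δ : ℝ)
    (U : Matrix.unitaryGroup (typicalSet (isHermitian_reducedA ψ) n δ) ℂ) : ℝ :=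
  ∑ j, outcomeProb (typicalState ψ n δ) (rotatedBasis ψ n δ U j) *
    traceNorm (postState (typicalState ψ n δ) (rotatedBasis ψ n δ U j) -
      reducedR (typicalState ψ n δ))

end Tripartite

end StateMerging

end

/-! The proof is a decoupling argument. For a random unit vector `e` in a space of dimension `d`,
the unnormalized state of the reference after outcome `e` has entries `⟨e|C|e⟩`, where the matrices
`C` are the blocks of the reduced state on `A ⊗ R`. The mean of such an entry is `Tr C / d`, so the
mean of the whole matrix is `ρ_R / d`. The fourth moments of a Haar column bound the variance by
`‖C‖₂² / d²` (`integral_norm_quadForm_sub_sq_le`). Summed over the blocks, the expected squared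
Hilbert–Schmidt deviation is at most the purity of `A ⊗ R` divided by `d²`, and by purity of the
global state this is the purity of `B`. Passing to the trace norm costs the square root of the
dimension of the support on `R`, and summing over the `d` outcomes cancels `1 / d`
(`integral_traceNorm_collapse_sub_le`).

For typical parts the support on `R` has dimension about `2^{n S(R)}` and the purity of `B` is about
`2^{-n S(B)}`, so the bound decays exponentially when `S(R) < S(B)`. The given `δ` may be too large
compared with the entropy gap. The cuts on `B` and `R` are therefore tightened to a smaller `δ'`; by
Chebyshev's inequality this moves the state by an arbitrarily small amount for large `n`, and
`integral_sum_traceNorm_le` shows that the disturbance is stable under such a change.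

All of this is done in the eigenbases of the reduced states, where typical projectors are
restrictions to sets of coordinates; `disturbance_eq` carries out this change of coordinates, and
`integral_disturbance_le` combines the estimates. -/

namespace StateMerging

/-! ### The trace norm by duality with contractions -/

section TraceNorm

open Matrix
open scoped ComplexOrder

variable {X Y : Type*} [Fintype X] [Fintype Y]

theorem normSq_nonneg (v : X → ℂ) : 0 ≤ normSq v :=
  Finset.sum_nonneg fun _ _ => by positivity

theorem ofReal_normSq (v : X → ℂ) : (normSq v : ℂ) = star v ⬝ᵥ v := by
  simp only [normSq, dotProduct, Pi.star_apply, Complex.ofReal_sum, RCLike.star_def,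
    Complex.conj_mul', Complex.ofReal_pow]

theorem ofReal_normSq_mulVec (N : Matrix X Y ℂ) (y : Y → ℂ) :
    (normSq (N *ᵥ y) : ℂ) = star y ⬝ᵥ ((Nᴴ * N) *ᵥ y) := by
  rw [ofReal_normSq, star_mulVec, ← mulVec_mulVec, dotProduct_mulVec]
  simp [dotProduct_mulVec]

theorem normSq_mulVec_of_isometry [DecidableEq Y] {N : Matrix X Y ℂ} (hN : Nᴴ * N = 1)
    (y : Y → ℂ) : normSq (N *ᵥ y) = normSq y := by
  have := ofReal_normSq_mulVec N y
  rw [hN, one_mulVec, ← ofReal_normSq] at this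
  exact_mod_cast this

theorem sqrt_normSq (v : X → ℂ) : √(normSq v) = ‖WithLp.toLp 2 v‖ := by
  rw [EuclideanSpace.norm_eq]; rfl

/-- Cauchy-Schwarz inequality. -/
theorem norm_star_dotProduct_le (v w : X → ℂ) :
    ‖star v ⬝ᵥ w‖ ≤ √(normSq v) * √(normSq w) := by
  have h := norm_inner_le_norm (𝕜 := ℂ) (WithLp.toLp 2 v) (WithLp.toLp 2 w)
  rw [EuclideanSpace.inner_eq_star_dotProduct, ← sqrt_normSq, ← sqrt_normSq] at h
  rwa [dotProduct_comm]

/-- Operators whose adjoint does not increase the norm. -/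
def IsContraction (W : Matrix X X ℂ) : Prop := ∀ v, normSq (Wᴴ *ᵥ v) ≤ normSq v

theorem isContraction_one [DecidableEq X] : IsContraction (1 : Matrix X X ℂ) := fun v => by simp

theorem IsContraction.neg {W : Matrix X X ℂ} (hW : IsContraction W) : IsContraction (-W) := by
  intro v
  have : normSq ((-W)ᴴ *ᵥ v) = normSq (Wᴴ *ᵥ v) := by simp [normSq, neg_mulVec]
  rw [this]; exact hW v

theorem IsContraction.conj [DecidableEq X] {W : Matrix X X ℂ} (hW : IsContraction W)
    {V : Matrix X X ℂ} (hV : Vᴴ * V = 1) : IsContraction (Vᴴ * W * V) := by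
  have hV' : V * Vᴴ = 1 := mul_eq_one_comm.mp hV
  intro v
  have : (Vᴴ * W * V)ᴴ *ᵥ v = Vᴴ *ᵥ (Wᴴ *ᵥ (V *ᵥ v)) := by
    simp [conjTranspose_mul, mulVec_mulVec, Matrix.mul_assoc]
  rw [this, normSq_mulVec_of_isometry (by simpa using hV')]
  exact (hW _).trans (normSq_mulVec_of_isometry hV v).le

theorem IsContraction.one_kronecker [DecidableEq Y] {W : Matrix X X ℂ} (hW : IsContraction W) :
    IsContraction ((1 : Matrix Y Y ℂ) ⊗ₖ W) := by
  intro v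
  have h : ∀ y x, (((1 : Matrix Y Y ℂ) ⊗ₖ W)ᴴ *ᵥ v) (y, x) = (Wᴴ *ᵥ fun x' => v (y, x')) x := by
    intro y x
    simp [mulVec, dotProduct, Fintype.sum_prod_type, one_apply, apply_ite, ite_mul,
      Finset.sum_ite_irrel]
  simp only [normSq, Fintype.sum_prod_type, h]
  exact Finset.sum_le_sum fun y _ => hW _

section

variable [DecidableEq X]

/-- Polar decomposition: the optimal `W` is `|M|⁻¹ M†`, with the inverse taken on the support of
`|M|`. -/
theorem exists_isContraction_traceNorm (M : Matrix X X ℂ) :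
    ∃ W, IsContraction W ∧ traceNorm M = (trace (W * M)).re := by
  set hM := isHermitian_conjTranspose_mul_self M
  set U : Matrix X X ℂ := hM.eigenvectorUnitary.1 with hU
  have hUU : Uᴴ * U = 1 := Unitary.coe_star_mul_self hM.eigenvectorUnitary
  have hUU' : U * Uᴴ = 1 := Unitary.coe_mul_star_self hM.eigenvectorUnitary
  set l := hM.eigenvalues with hl
  have hl0 : ∀ i, 0 ≤ l i := (posSemidef_conjTranspose_mul_self M).eigenvalues_nonneg
  have hspec : Mᴴ * M = U * diagonal (fun i => (l i : ℂ)) * Uᴴ := hM.spectral_theorem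
  set N := M * U with hN
  have hNN : Nᴴ * N = diagonal (fun i => (l i : ℂ)) := by
    calc Nᴴ * N = Uᴴ * (Mᴴ * M) * U := by simp [hN, conjTranspose_mul, Matrix.mul_assoc]
      _ = (Uᴴ * U) * diagonal (fun i => (l i : ℂ)) * (Uᴴ * U) := by
        rw [hspec]; simp only [Matrix.mul_assoc]
      _ = _ := by simp [hUU]
  -- Since `0⁻¹ = 0`, this is the pseudo-inverse of the singular values, and a singular `M` needs no
  -- separate treatment.
  set D : Matrix X X ℂ := diagonal fun i => (((√(l i))⁻¹ : ℝ) : ℂ) with hD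
  have hDH : Dᴴ = D := by
    rw [hD, diagonal_conjTranspose]; congr 1; ext i; simp
  refine ⟨U * D * Nᴴ, fun v => ?_, ?_⟩
  · have h1 : (U * D * Nᴴ)ᴴ *ᵥ v = N *ᵥ (D *ᵥ (Uᴴ *ᵥ v)) := by
      simp [conjTranspose_mul, hDH, mulVec_mulVec, Matrix.mul_assoc]
    rw [h1, ← normSq_mulVec_of_isometry (N := Uᴴ) (by simpa using hUU') v]
    generalize Uᴴ *ᵥ v = x
    have h2 : normSq (N *ᵥ (D *ᵥ x)) = ∑ i, l i * ‖(D *ᵥ x) i‖ ^ 2 := by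
      have := ofReal_normSq_mulVec N (D *ᵥ x)
      rw [hNN] at this
      apply Complex.ofReal_injective
      rw [this]
      simp only [dotProduct, mulVec_diagonal, Pi.star_apply, RCLike.star_def, Complex.ofReal_sum,
        Complex.ofReal_mul, Complex.ofReal_pow]
      exact Finset.sum_congr rfl fun i _ => by rw [← Complex.conj_mul']; ring
    rw [h2]
    refine Finset.sum_le_sum fun i _ => ?_
    rw [hD, mulVec_diagonal, norm_mul, mul_pow, ← mul_assoc]
    refine mul_le_of_le_one_left (by positivity) ?_
    rw [Complex.norm_real, Real.norm_eq_abs, sq_abs, inv_pow, Real.sq_sqrt (hl0 i)]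
    exact mul_inv_le_one
  · have h1 : trace (U * D * Nᴴ * M) = trace (D * (Nᴴ * N)) := by
      rw [Matrix.mul_assoc, Matrix.mul_assoc, trace_mul_comm, hN]
      simp only [Matrix.mul_assoc]
    rw [h1, hNN, hD, diagonal_mul_diagonal, trace_diagonal, Complex.re_sum]
    refine Finset.sum_congr rfl fun i _ => ?_
    rw [← Complex.ofReal_mul, Complex.ofReal_re]
    rw [inv_mul_eq_div, Real.div_sqrt]

/-- The trace is expanded in an eigenbasis `u_i` of `M† M`. Cauchy–Schwarz bounds each term by `‖W†
u_i‖ ‖M u_i‖`, and `‖M u_i‖` is the `i`-th singular value. -/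
theorem re_trace_mul_le_traceNorm {W : Matrix X X ℂ} (hW : IsContraction W)
    (M : Matrix X X ℂ) : (trace (W * M)).re ≤ traceNorm M := by
  set hM := isHermitian_conjTranspose_mul_self M
  set U : Matrix X X ℂ := hM.eigenvectorUnitary.1 with hU
  have hUU : Uᴴ * U = 1 := Unitary.coe_star_mul_self hM.eigenvectorUnitary
  have hUU' : U * Uᴴ = 1 := Unitary.coe_mul_star_self hM.eigenvectorUnitary
  set l := hM.eigenvalues with hl
  have hspec : Mᴴ * M = U * diagonal (fun i => (l i : ℂ)) * Uᴴ := hM.spectral_theorem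
  have h1 : trace (W * M) = ∑ i, star (Wᴴ *ᵥ (U *ᵥ Pi.single i 1)) ⬝ᵥ (M *ᵥ (U *ᵥ Pi.single i 1)) := by
    have : trace (W * M) = trace (Uᴴ * (W * M) * U) := by
      rw [trace_mul_comm _ U, ← Matrix.mul_assoc, hUU', Matrix.one_mul]
    rw [this, trace]
    refine Finset.sum_congr rfl fun i _ => ?_
    rw [star_mulVec, star_mulVec, conjTranspose_conjTranspose, vecMul_vecMul, mulVec_mulVec,
      ← dotProduct_mulVec, mulVec_mulVec, dotProduct_mulVec]
    simp [← Matrix.mul_assoc, Pi.star_single]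
  have hnorm : ∀ i, normSq (M *ᵥ (U *ᵥ Pi.single i 1)) = l i := by
    intro i
    apply Complex.ofReal_injective
    rw [mulVec_mulVec, ofReal_normSq_mulVec]
    have : (M * U)ᴴ * (M * U) = diagonal (fun i => (l i : ℂ)) := by
      calc (M * U)ᴴ * (M * U) = Uᴴ * (Mᴴ * M) * U := by
            simp [conjTranspose_mul, Matrix.mul_assoc]
        _ = (Uᴴ * U) * diagonal (fun i => (l i : ℂ)) * (Uᴴ * U) := by
          rw [hspec]; simp only [Matrix.mul_assoc]
        _ = _ := by simp [hUU]
    rw [this]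
    simp [Pi.star_single]
  rw [h1, Complex.re_sum, traceNorm]
  refine Finset.sum_le_sum fun i _ => ?_
  refine (Complex.re_le_norm _).trans ((norm_star_dotProduct_le _ _).trans ?_)
  rw [hnorm]
  refine mul_le_of_le_one_left (Real.sqrt_nonneg _) ?_
  rw [Real.sqrt_le_one]
  refine (hW _).trans ?_
  rw [normSq_mulVec_of_isometry hUU, normSq]
  simp [Pi.single_apply, apply_ite]

/-- The trace norm is thus a maximum of real-linear functionals; the triangle inequality, scaling
and unitary invariance follow without reference to singular values. -/
theorem traceNorm_le_of_forall {M : Matrix X X ℂ} {c : ℝ}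
    (h : ∀ W, IsContraction W → (trace (W * M)).re ≤ c) : traceNorm M ≤ c := by
  obtain ⟨W, hW, hWM⟩ := exists_isContraction_traceNorm M
  exact hWM ▸ h W hW

theorem traceNorm_add_le (M N : Matrix X X ℂ) :
    traceNorm (M + N) ≤ traceNorm M + traceNorm N :=
  traceNorm_le_of_forall fun W hW => by
    rw [Matrix.mul_add, trace_add, Complex.add_re]
    exact add_le_add (re_trace_mul_le_traceNorm hW M) (re_trace_mul_le_traceNorm hW N)

theorem traceNorm_neg (M : Matrix X X ℂ) : traceNorm (-M) = traceNorm M := by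
  have h : ∀ M : Matrix X X ℂ, traceNorm (-M) ≤ traceNorm M := fun M =>
    traceNorm_le_of_forall fun W hW => by
      simpa using re_trace_mul_le_traceNorm hW.neg M
  exact (h M).antisymm (by simpa using h (-M))

theorem traceNorm_sub_comm (M N : Matrix X X ℂ) : traceNorm (M - N) = traceNorm (N - M) := by
  rw [← traceNorm_neg, neg_sub]

theorem traceNorm_sub_le (M N K : Matrix X X ℂ) :
    traceNorm (M - K) ≤ traceNorm (M - N) + traceNorm (N - K) := by
  simpa using traceNorm_add_le (M - N) (N - K)

theorem traceNorm_sum_le {ι : Type*} (s : Finset ι) (M : ι → Matrix X X ℂ) :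
    traceNorm (∑ i ∈ s, M i) ≤ ∑ i ∈ s, traceNorm (M i) :=
  traceNorm_le_of_forall fun W hW => by
    rw [Finset.mul_sum, trace_sum, Complex.re_sum]
    exact Finset.sum_le_sum fun i _ => re_trace_mul_le_traceNorm hW (M i)

theorem traceNorm_smul {c : ℝ} (hc : 0 ≤ c) (M : Matrix X X ℂ) :
    traceNorm ((c : ℂ) • M) = c * traceNorm M := by
  refine le_antisymm (traceNorm_le_of_forall fun W hW => ?_) ?_
  · simp only [Matrix.mul_smul, trace_smul, smul_eq_mul, Complex.re_ofReal_mul]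
    exact mul_le_mul_of_nonneg_left (re_trace_mul_le_traceNorm hW M) hc
  · obtain ⟨W, hW, hWM⟩ := exists_isContraction_traceNorm M
    refine le_trans (le_of_eq ?_) (re_trace_mul_le_traceNorm hW _)
    simp only [Matrix.mul_smul, trace_smul, smul_eq_mul, Complex.re_ofReal_mul, hWM]

theorem abs_re_trace_le_traceNorm (M : Matrix X X ℂ) : |(trace M).re| ≤ traceNorm M := by
  rw [abs_le']
  exact ⟨by simpa using re_trace_mul_le_traceNorm isContraction_one M,
    by simpa using re_trace_mul_le_traceNorm isContraction_one.neg M⟩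

theorem traceNorm_conj {V : Matrix X X ℂ} (hV : Vᴴ * V = 1) (M : Matrix X X ℂ) :
    traceNorm (V * M * Vᴴ) = traceNorm M := by
  have h : ∀ {V : Matrix X X ℂ}, Vᴴ * V = 1 → ∀ M, traceNorm (V * M * Vᴴ) ≤ traceNorm M :=
    fun {V} hV M => traceNorm_le_of_forall fun W hW => by
      have : trace (W * (V * M * Vᴴ)) = trace (Vᴴ * W * V * M) := by
        rw [← Matrix.mul_assoc, trace_mul_comm]; simp only [Matrix.mul_assoc]
      rw [this]
      exact re_trace_mul_le_traceNorm (hW.conj hV) M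
  refine (h hV M).antisymm ?_
  have h2 := h (V := Vᴴ) (by simpa using mul_eq_one_comm.mp hV) (V * M * Vᴴ)
  have : Vᴴ * (V * M * Vᴴ) * Vᴴᴴ = (Vᴴ * V) * M * (Vᴴ * V) := by
    simp only [Matrix.mul_assoc, conjTranspose_conjTranspose]
  rwa [this, hV, Matrix.one_mul, Matrix.mul_one] at h2

/-- Only the rows of `W` indexed by `S` enter `Tr (W M)`, and each has norm at most one.
Cauchy–Schwarz therefore gives a factor depending on the size of the support, not on the full
dimension. -/
theorem traceNorm_le_sqrt_card_mul {M : Matrix X X ℂ} (S : Finset X)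
    (hS : ∀ x, ∀ y ∉ S, M x y = 0) :
    traceNorm M ≤ √(S.card : ℝ) * √(∑ x, ∑ y, ‖M x y‖ ^ 2) := by
  refine traceNorm_le_of_forall fun W hW => ?_
  have hrow : ∀ x, ∑ y, ‖W x y‖ ^ 2 ≤ 1 := fun x => by
    have := hW (Pi.single x 1)
    simpa [normSq, Pi.single_apply, apply_ite] using this
  have h1 : trace (W * M) = ∑ p ∈ S ×ˢ Finset.univ, W p.1 p.2 * M p.2 p.1 := by
    rw [Finset.sum_product, trace]
    simp only [diag_apply, mul_apply]
    refine (Finset.sum_subset (Finset.subset_univ S) fun x _ hx => ?_).symm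
    exact Finset.sum_eq_zero fun y _ => by rw [hS y x hx, mul_zero]
  calc (trace (W * M)).re ≤ ‖trace (W * M)‖ := Complex.re_le_norm _
    _ ≤ ∑ p ∈ S ×ˢ Finset.univ, ‖W p.1 p.2‖ * ‖M p.2 p.1‖ := by
      rw [h1]
      exact (norm_sum_le _ _).trans (Finset.sum_le_sum fun p _ => (norm_mul _ _).le)
    _ ≤ √(∑ p ∈ S ×ˢ Finset.univ, ‖W p.1 p.2‖ ^ 2) *
        √(∑ p ∈ S ×ˢ Finset.univ, ‖M p.2 p.1‖ ^ 2) := Real.sum_mul_le_sqrt_mul_sqrt _ _ _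
    _ ≤ _ := by
      gcongr
      · rw [Finset.sum_product, Finset.card_eq_sum_ones, Nat.cast_sum]
        exact Finset.sum_le_sum fun x _ => by simpa using hrow x
      · rw [Finset.sum_product, Finset.sum_comm]
        exact Finset.sum_le_sum fun y _ => Finset.sum_le_sum_of_subset_of_nonneg
          (Finset.subset_univ S) fun _ _ _ => by positivity

/-- Continuity makes every integrand below integrable, the unitary group being compact. -/
theorem continuous_traceNorm : Continuous (traceNorm : Matrix X X ℂ → ℝ) := by
  rw [continuous_iff_continuousAt]
  intro M
  have hbound : ∀ N, |traceNorm N - traceNorm M| ≤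
      √((Finset.univ : Finset X).card : ℝ) * √(∑ x, ∑ y, ‖N x y - M x y‖ ^ 2) := by
    intro N
    refine le_trans ?_ (traceNorm_le_sqrt_card_mul (M := N - M) Finset.univ (by simp))
    have h1 := traceNorm_sub_le N M 0
    have h2 := traceNorm_sub_le M N 0
    rw [traceNorm_sub_comm M N] at h2
    simp only [sub_zero] at h1 h2
    rw [abs_le]; constructor <;> linarith
  rw [ContinuousAt, tendsto_iff_norm_sub_tendsto_zero]
  refine squeeze_zero (fun _ => norm_nonneg _) hbound ?_
  have hc : Continuous fun N : Matrix X X ℂ => √((Finset.univ : Finset X).card : ℝ) *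
      √(∑ x, ∑ y, ‖N x y - M x y‖ ^ 2) := by
    fun_prop
  simpa using hc.tendsto M

end

/-- The partial trace is dual to `W ↦ 1 ⊗ W`, which preserves contractions; test operators for a
reduced state thus lift to the full system. -/
theorem trace_mul_traceLeft [DecidableEq Y] (W : Matrix X X ℂ) (M : Matrix (Y × X) (Y × X) ℂ) :
    trace (W * traceLeft M) = trace (((1 : Matrix Y Y ℂ) ⊗ₖ W) * M) := by
  simp only [trace, diag_apply, mul_apply, traceLeft, of_apply, kroneckerMap_apply,
    Fintype.sum_prod_type, one_apply, ite_mul, one_mul, zero_mul, Finset.mul_sum,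
    Finset.sum_ite_irrel, Finset.sum_const_zero, Finset.sum_ite_eq, Finset.mem_univ, if_true]
  exact (Finset.sum_congr rfl fun _ _ => Finset.sum_comm).trans Finset.sum_comm

theorem trace_mul_ketBra (W : Matrix X X ℂ) (v : X → ℂ) :
    trace (W * ketBra v) = star (Wᴴ *ᵥ v) ⬝ᵥ v := by
  rw [ketBra, mul_vecMulVec, trace_vecMulVec, star_mulVec, conjTranspose_conjTranspose,
    dotProduct_comm, dotProduct_mulVec]

/-- The trace distance of the reductions of two vectors. -/
theorem traceNorm_traceLeft_sub_le [DecidableEq X] (v w : Y × X → ℂ) :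
    traceNorm (traceLeft (ketBra v) - traceLeft (ketBra w)) ≤
      √(normSq (v - w)) * (√(normSq v) + √(normSq w)) := by
  classical
  refine traceNorm_le_of_forall fun W hW => ?_
  have hZ := hW.one_kronecker (Y := Y)
  set Z := (1 : Matrix Y Y ℂ) ⊗ₖ W
  rw [Matrix.mul_sub, trace_sub, trace_mul_traceLeft, trace_mul_traceLeft, trace_mul_ketBra,
    trace_mul_ketBra]
  -- The difference of two values of a quadratic form is split so that each summand contains `v - w`
  -- once.
  have h : star (Zᴴ *ᵥ v) ⬝ᵥ v - star (Zᴴ *ᵥ w) ⬝ᵥ w =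
      star (Zᴴ *ᵥ (v - w)) ⬝ᵥ v + star (Zᴴ *ᵥ w) ⬝ᵥ (v - w) := by
    simp only [mulVec_sub, star_sub, sub_dotProduct, dotProduct_sub]; ring
  have hb : ∀ a b, ‖star (Zᴴ *ᵥ a) ⬝ᵥ b‖ ≤ √(normSq a) * √(normSq b) := fun a b =>
    (norm_star_dotProduct_le _ _).trans
      (mul_le_mul_of_nonneg_right (Real.sqrt_le_sqrt (hZ a)) (Real.sqrt_nonneg _))
  rw [h]
  refine (Complex.re_le_norm _).trans ((norm_add_le _ _).trans ?_)
  have h1 := hb (v - w) v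
  have h2 := hb w (v - w)
  linarith

theorem traceNorm_traceLeft_le [DecidableEq X] (v : Y × X → ℂ) :
    traceNorm (traceLeft (ketBra v)) ≤ normSq v := by
  have h := traceNorm_traceLeft_sub_le v 0
  have h0 : traceLeft (ketBra (0 : Y × X → ℂ)) = 0 := by
    ext x y; simp [traceLeft, ketBra, vecMulVec]
  have h1 : normSq (0 : Y × X → ℂ) = 0 := by simp [normSq]
  rwa [h0, sub_zero, sub_zero, h1, Real.sqrt_zero, add_zero,
    Real.mul_self_sqrt (normSq_nonneg v)] at h

end TraceNorm

/-! ### Fourth moments of a column of a Haar random unitary -/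

section Haar

open Matrix ComplexConjugate

variable {T : Type*} [Fintype T] [DecidableEq T]

instance instIsProbabilityMeasureHaarUnitary : IsProbabilityMeasure (haarUnitary T) :=
  ⟨by simpa [haarUnitary] using
    Measure.haarMeasure_self (K₀ := (⊤ : TopologicalSpace.PositiveCompacts (unitaryGroup T ℂ)))⟩

instance instIsMulLeftInvariantHaarUnitary : (haarUnitary T).IsMulLeftInvariant := by
  unfold haarUnitary; infer_instance

theorem integrable_haarUnitary {E : Type*} [NormedAddCommGroup E]
    {f : unitaryGroup T ℂ → E} (hf : Continuous f) : Integrable f (haarUnitary T) :=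
  hf.integrable_of_hasCompactSupport (HasCompactSupport.of_compactSpace f)

theorem continuous_unitaryGroup_entry (i j : T) :
    Continuous fun U : unitaryGroup T ℂ => (U : Matrix T T ℂ) i j :=
  continuous_subtype_val.matrix_elem i j

theorem continuous_colMoment_integrand (j i k i' k' : T) :
    Continuous fun U : unitaryGroup T ℂ =>
      conj (U.1 i j) * U.1 k j * (U.1 i' j * conj (U.1 k' j)) :=
  ((Complex.continuous_conj.comp (continuous_unitaryGroup_entry i j)).mul
    (continuous_unitaryGroup_entry k j)).mul ((continuous_unitaryGroup_entry i' j).mul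
    (Complex.continuous_conj.comp (continuous_unitaryGroup_entry k' j)))

/-- The fourth moments of the entries of a column of a Haar random unitary matrix. -/
noncomputable def colMoment (j i k i' k' : T) : ℂ :=
  ∫ U : unitaryGroup T ℂ, conj (U.1 i j) * U.1 k j * (U.1 i' j * conj (U.1 k' j)) ∂haarUnitary T

theorem colMoment_eq_of_mul (g : unitaryGroup T ℂ) (j i k i' k' : T) :
    colMoment j i k i' k' = ∫ U : unitaryGroup T ℂ,
      conj ((g.1 * U.1) i j) * (g.1 * U.1) k j *
        ((g.1 * U.1) i' j * conj ((g.1 * U.1) k' j)) ∂haarUnitary T :=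
  (integral_mul_left_eq_self (fun U : unitaryGroup T ℂ =>
    conj (U.1 i j) * U.1 k j * (U.1 i' j * conj (U.1 k' j))) g).symm

/-- Invariance of the Haar measure under left multiplication by a diagonal unitary. -/
theorem colMoment_eq_phase_mul (c : T → ℂ) (hc : ∀ i, c i * conj (c i) = 1) (j i k i' k' : T) :
    colMoment j i k i' k' =
      conj (c i) * c k * (c i' * conj (c k')) * colMoment j i k i' k' := by
  have hg : diagonal c ∈ unitaryGroup T ℂ := by
    rw [mem_unitaryGroup_iff, star_eq_conjTranspose, diagonal_conjTranspose, diagonal_mul_diagonal,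
      ← diagonal_one]
    congr 1; ext i; exact hc i
  conv_lhs => rw [colMoment_eq_of_mul ⟨_, hg⟩]
  rw [colMoment, ← integral_const_mul]
  refine integral_congr_ae (ae_of_all _ fun U => ?_)
  simp only [diagonal_mul, map_mul]
  ring

theorem colMoment_eq_zero {j i k i' k' : T} (h1 : ¬(i = k ∧ i' = k')) (h2 : ¬(i = i' ∧ k = k')) :
    colMoment j i k i' k' = 0 := by
  -- A phase `I` at one coordinate, instead of a sign: moments of the type `conj(u_i)² u_k²` are
  -- unchanged by a sign but change sign under `I`.
  have key : ∀ p, colMoment j i k i' k' = _ := fun p =>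
    colMoment_eq_phase_mul (fun x => if x = p then Complex.I else 1)
      (fun x => by split_ifs <;> simp) j i k i' k'
  have hne : ∀ z : ℂ, z ≠ 1 → ∀ m : ℂ, m = z * m → m = 0 := fun z hz m hm => by
    have : (1 - z) * m = 0 := by linear_combination hm
    exact (mul_eq_zero.mp this).resolve_left (sub_ne_zero.mpr hz.symm)
  have hI : (-Complex.I : ℂ) ≠ 1 := fun h => by simpa using congrArg Complex.re h
  have hI2 : (-1 : ℂ) ≠ 1 := by norm_num
  by_cases hik : i = k
  · subst hik
    have hk : i' ≠ k' := fun h => h1 ⟨rfl, h⟩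
    refine hne _ ?_ _ (key k')
    by_cases hi : i = k' <;> simp [hk, hi, hI]
  · by_cases hii : i = i'
    · subst hii
      have hk : k ≠ k' := fun h => h2 ⟨rfl, h⟩
      refine hne _ ?_ _ (key k')
      by_cases hi : i = k' <;> simp [hk, hi, hI]
    · refine hne _ ?_ _ (key i)
      by_cases hi : k' = i <;> simp [Ne.symm hik, Ne.symm hii, hi, hI, hI2]

/-- The reflection `1 - c |v⟩⟨v|`, which is unitary if `c ⟨v|v⟩ = 2`. -/
theorem reflection_mem_unitaryGroup {c : ℝ} {v : T → ℂ} (h : c * normSq v = 2) :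
    1 - (c : ℂ) • vecMulVec v (star v) ∈ unitaryGroup T ℂ := by
  have h' : (c : ℂ) * (star v ⬝ᵥ v) = 2 := by
    rw [← ofReal_normSq]; exact_mod_cast h
  have hs : star (1 - (c : ℂ) • vecMulVec v (star v)) = 1 - (c : ℂ) • vecMulVec v (star v) := by
    rw [star_sub, star_one, star_smul, star_eq_conjTranspose, conjTranspose_vecMulVec, star_star]
    simp
  rw [mem_unitaryGroup_iff, hs]
  have h2 : vecMulVec v (star v) * vecMulVec v (star v) =
      (star v ⬝ᵥ v) • vecMulVec v (star v) := by
    rw [vecMulVec_mul_vecMulVec, vecMulVec_smul]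
  simp only [Matrix.mul_sub, Matrix.sub_mul, Matrix.smul_mul, Matrix.mul_smul, h2, Matrix.one_mul,
    Matrix.mul_one, smul_smul]
  rw [h']
  module

theorem reflection_mul_apply (c : ℂ) (v : T → ℂ) (U : Matrix T T ℂ) (i j : T) :
    ((1 - c • vecMulVec v (star v)) * U) i j = U i j - c * v i * (star v ⬝ᵥ fun k => U k j) := by
  rw [Matrix.sub_mul, Matrix.one_mul, Matrix.smul_mul, vecMulVec_mul]
  simp [vecMulVec, vecMul, mul_assoc]

/-- The reflection along `e_p - e_q` exchanges the two coordinates. -/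
theorem colMoment_self_eq (j p q : T) : colMoment j p p p p = colMoment j q q q q := by
  by_cases hpq : p = q
  · rw [hpq]
  set v : T → ℂ := Pi.single p 1 - Pi.single q 1
  have hv : (1 : ℝ) * normSq v = 2 := by
    have : (normSq v : ℂ) = 2 := by
      rw [ofReal_normSq]
      simp [v, hpq, Ne.symm hpq, Pi.star_single]; norm_num
    rw [one_mul]; exact_mod_cast this
  rw [colMoment_eq_of_mul ⟨_, reflection_mem_unitaryGroup hv⟩, colMoment]
  refine integral_congr_ae (ae_of_all _ fun U => ?_)
  have : ((1 - ((1 : ℝ) : ℂ) • vecMulVec v (star v)) * U.1) p j = U.1 q j := by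
    rw [reflection_mul_apply]; simp [v, hpq, Pi.star_single]
  simp only [this]

/-- Invariance under a map `u_p ↦ a u_p + b u_q` with real `a² + b² = 1` gives `M = (a⁴ + b⁴) M + 4
a² b² m` for the two moments, the unbalanced terms having mean zero. Hence `M = 2 m` when `a b ≠ 0`.
-/
theorem colMoment_self_eq_two_mul {j p q : T} (hpq : p ≠ q) :
    colMoment j p p p p = 2 * colMoment j p p q q := by
  -- This vector yields the rational choice `a = 3/5`, `b = 4/5`.
  set v : T → ℂ := Pi.single p 1 - Pi.single q 2
  have hv : (2 / 5 : ℝ) * normSq v = 2 := by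
    have : (normSq v : ℂ) = 5 := by
      rw [ofReal_normSq]
      simp [v, hpq, Ne.symm hpq, Pi.star_single]; norm_num
    have : normSq v = 5 := by exact_mod_cast this
    rw [this]; norm_num
  have hx : ∀ U : unitaryGroup T ℂ,
      ((1 - ((2 / 5 : ℝ) : ℂ) • vecMulVec v (star v)) * U.1) p j =
        3 / 5 * U.1 p j + 4 / 5 * U.1 q j := fun U => by
    rw [reflection_mul_apply]; simp [v, hpq, Pi.star_single]; ring
  have h := colMoment_eq_of_mul ⟨_, reflection_mem_unitaryGroup hv⟩ j p p p p
  simp only [hx] at h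
  let f : T → T → T → T → unitaryGroup T ℂ → ℂ := fun i k i' k' U =>
    conj (U.1 i j) * U.1 k j * (U.1 i' j * conj (U.1 k' j))
  have hf : ∀ i k i' k', ∫ U, f i k i' k' U ∂haarUnitary T = colMoment j i k i' k' :=
    fun _ _ _ _ => rfl
  have hfi : ∀ (c : ℂ) i k i' k', Integrable (fun U => c * f i k i' k' U) (haarUnitary T) :=
    fun c i k i' k' =>
      (integrable_haarUnitary (continuous_colMoment_integrand j i k i' k')).const_mul c
  have hexp : ∀ U : unitaryGroup T ℂ, conj (3 / 5 * U.1 p j + 4 / 5 * U.1 q j) *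
      (3 / 5 * U.1 p j + 4 / 5 * U.1 q j) * ((3 / 5 * U.1 p j + 4 / 5 * U.1 q j) *
        conj (3 / 5 * U.1 p j + 4 / 5 * U.1 q j)) =
      81 / 625 * f p p p p U + 256 / 625 * f q q q q U + 576 / 625 * f p p q q U +
      144 / 625 * f p q q p U + 144 / 625 * f q p p q U + 216 / 625 * f p p p q U +
      216 / 625 * f p p q p U + 384 / 625 * f q q p q U + 384 / 625 * f q q q p U := fun U => by
    simp only [f, map_add, map_mul, map_div₀, map_ofNat]; ring
  simp only [hexp] at h
  rw [integral_add (by fun_prop) (by fun_prop), integral_add (by fun_prop) (by fun_prop),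
    integral_add (by fun_prop) (by fun_prop), integral_add (by fun_prop) (by fun_prop),
    integral_add (by fun_prop) (by fun_prop), integral_add (by fun_prop) (by fun_prop),
    integral_add (by fun_prop) (by fun_prop), integral_add (by fun_prop) (by fun_prop)] at h
  simp only [integral_const_mul, hf] at h
  have hqp := hpq.symm
  rw [colMoment_eq_zero (i := p) (k := q) (i' := q) (k' := p) (by tauto) (by tauto),
    colMoment_eq_zero (i := q) (k := p) (i' := p) (k' := q) (by tauto) (by tauto),
    colMoment_eq_zero (i := p) (k := p) (i' := p) (k' := q) (by tauto) (by tauto),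
    colMoment_eq_zero (i := p) (k := p) (i' := q) (k' := p) (by tauto) (by tauto),
    colMoment_eq_zero (i := q) (k := q) (i' := p) (k' := q) (by tauto) (by tauto),
    colMoment_eq_zero (i := q) (k := q) (i' := q) (k' := p) (by tauto) (by tauto),
    colMoment_self_eq j q p] at h
  linear_combination (625 / 288 : ℂ) * h

/-- Only the two pairings of conjugated with unconjugated indices survive, with equal weights. When
all indices agree both pairings count, which is the factor two above. -/
theorem colMoment_eq_ite (j i k i' k' : T) :
    colMoment j i k i' k' = colMoment j j j j j / 2 *
      ((if i = k ∧ i' = k' then 1 else 0) + (if i = i' ∧ k = k' then 1 else 0)) := by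
  have hdiff : ∀ p q : T, p ≠ q → colMoment j p p q q = colMoment j j j j j / 2 := fun p q h => by
    rw [colMoment_self_eq j j p, colMoment_self_eq_two_mul h]; ring
  by_cases h1 : i = k ∧ i' = k'
  · obtain ⟨rfl, rfl⟩ := h1
    by_cases h2 : i = i'
    · subst h2
      simp only [and_self, if_true]
      rw [colMoment_self_eq j i j]; ring
    · rw [hdiff _ _ h2]; simp [h2]
  · by_cases h2 : i = i' ∧ k = k'
    · obtain ⟨rfl, rfl⟩ := h2
      have hik : i ≠ k := fun h => h1 ⟨h, h⟩
      have : colMoment j i k i k = colMoment j i i k k := by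
        simp only [colMoment]; congr 1; ext U; ring
      rw [this, hdiff _ _ hik]; simp [hik]
    · rw [colMoment_eq_zero h1 h2]; simp [h1, h2]

theorem sum_conj_mul_col (U : unitaryGroup T ℂ) (j : T) : ∑ i, conj (U.1 i j) * U.1 i j = 1 := by
  have h := congrFun (congrFun (mem_unitaryGroup_iff'.mp U.2) j) j
  simpa [mul_apply, star_apply] using h

/-- The weight is fixed by the unit norm of the column: summing `E |u_i|² |u_k|²` over all `i, k`
gives `1`, and the pairings contribute `d² + d` times the weight. -/
theorem colMoment_self (j : T) : colMoment j j j j j / 2 =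
    (((Fintype.card T : ℝ) * (Fintype.card T + 1))⁻¹ : ℝ) := by
  have h1 : ∑ i, ∑ k, colMoment j i i k k = 1 := by
    have hint : ∀ i k : T, Integrable (fun U : unitaryGroup T ℂ =>
        conj (U.1 i j) * U.1 i j * (U.1 k j * conj (U.1 k j))) (haarUnitary T) := fun i k =>
      integrable_haarUnitary (continuous_colMoment_integrand j i i k k)
    simp only [colMoment]
    rw [Finset.sum_congr rfl fun i _ => (integral_finsetSum _ fun k _ => hint i k).symm,
      ← integral_finsetSum _ fun i _ => integrable_finsetSum _ fun k _ => hint i k]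
    have : ∀ U : unitaryGroup T ℂ, ∑ i, ∑ k,
        conj (U.1 i j) * U.1 i j * (U.1 k j * conj (U.1 k j)) = 1 := fun U => by
      rw [← Finset.sum_mul_sum, sum_conj_mul_col, one_mul]
      simpa only [mul_comm] using sum_conj_mul_col U j
    simp [this]
  have hd : (Fintype.card T : ℂ) ≠ 0 := by
    exact_mod_cast (Fintype.card_pos_iff.mpr ⟨j⟩).ne'
  have hd' : (Fintype.card T : ℂ) + 1 ≠ 0 := by
    exact_mod_cast Nat.succ_ne_zero (Fintype.card T)
  have hm : ∀ i k : T, colMoment j i i k k =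
      colMoment j j j j j / 2 * (1 + if i = k then 1 else 0) := fun i k => by
    rw [colMoment_eq_ite]; simp
  generalize colMoment j j j j j / 2 = b at hm ⊢
  simp only [hm, mul_add, mul_ite, mul_one, mul_zero, Finset.sum_add_distrib,
    Finset.sum_const, Finset.card_univ, Finset.sum_ite_eq, Finset.mem_univ] at h1
  push_cast
  rw [← mul_eq_one_iff_eq_inv₀ (mul_ne_zero hd hd')]
  simp only [if_true, nsmul_eq_mul] at h1
  linear_combination h1

/-- The variance of `⟨u|C|u⟩` for a column `u` of a Haar random unitary matrix. -/
theorem integral_norm_quadForm_sub_sq_le (C : Matrix T T ℂ) (j : T) :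
    ∫ U : unitaryGroup T ℂ, ‖∑ i, ∑ k, conj (U.1 i j) * U.1 k j * C i k -
      (Fintype.card T : ℂ)⁻¹ * trace C‖ ^ 2 ∂haarUnitary T ≤
      (∑ i, ∑ k, ‖C i k‖ ^ 2) / (Fintype.card T : ℝ) ^ 2 := by
  have hdpos : (0 : ℝ) < Fintype.card T := by exact_mod_cast Fintype.card_pos_iff.mpr ⟨j⟩
  have hd : (Fintype.card T : ℂ) ≠ 0 := by exact_mod_cast hdpos.ne'
  set t := (Fintype.card T : ℂ)⁻¹ * trace C with ht
  have htr : trace C = Fintype.card T * t := by rw [ht]; field_simp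
  -- With the mean removed the matrix is traceless, so one pairing contributes `|Tr C0|² = 0` and
  -- the other the squared Hilbert–Schmidt norm.
  set C0 : Matrix T T ℂ := C - t • 1 with hC0
  have htr0 : ∑ i, C0 i i = 0 := by
    have : trace C0 = 0 := by rw [hC0, trace_sub, trace_smul, trace_one, htr, smul_eq_mul]; ring
    exact this
  have hz : ∀ U : unitaryGroup T ℂ, ∑ i, ∑ k, conj (U.1 i j) * U.1 k j * C i k - t =
      ∑ i, ∑ k, conj (U.1 i j) * U.1 k j * C0 i k := fun U => by
    simp only [hC0, Matrix.sub_apply, Matrix.smul_apply, one_apply, smul_eq_mul, mul_ite, mul_one,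
      mul_zero, mul_sub, Finset.sum_sub_distrib, Finset.sum_ite_eq, Finset.mem_univ, if_true,
      ← Finset.sum_mul, sum_conj_mul_col, one_mul]
  simp only [hz]
  -- Pythagoras: `C0` is orthogonal to the identity.
  have hC0C : ∑ i, ∑ k, ‖C0 i k‖ ^ 2 ≤ ∑ i, ∑ k, ‖C i k‖ ^ 2 := by
    have : ∑ i, ∑ k, ‖C i k‖ ^ 2 = ∑ i, ∑ k, ‖C0 i k‖ ^ 2 + Fintype.card T * ‖t‖ ^ 2 := by
      apply Complex.ofReal_injective
      have hC : ∀ i k, C i k = C0 i k + t * (1 : Matrix T T ℂ) i k := fun i k => by simp [hC0]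
      have hent : ∀ i k, conj (C i k) * C i k = conj (C0 i k) * C0 i k +
          (if i = k then t * conj (C0 i k) + conj t * C0 i k + conj t * t else 0) := fun i k => by
        rw [hC, one_apply]
        split_ifs <;> simp
        ring
      have htr0' : ∑ i, conj (C0 i i) = 0 := by rw [← map_sum, htr0, map_zero]
      push_cast
      simp only [← Complex.conj_mul', hent, Finset.sum_add_distrib, Finset.sum_ite_eq,
        Finset.mem_univ, if_true, ← Finset.mul_sum, htr0, htr0']
      simp
      ring
    rw [this]
    have : 0 ≤ (Fintype.card T : ℝ) * ‖t‖ ^ 2 := by positivity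
    linarith
  have hval : ((∫ U : unitaryGroup T ℂ,
      ‖∑ i, ∑ k, conj (U.1 i j) * U.1 k j * C0 i k‖ ^ 2 ∂haarUnitary T : ℝ) : ℂ) =
      ((((Fintype.card T : ℝ) * (Fintype.card T + 1))⁻¹ * ∑ i, ∑ k, ‖C0 i k‖ ^ 2 : ℝ) : ℂ) := by
    rw [← integral_complex_ofReal]
    have hexp : ∀ U : unitaryGroup T ℂ,
        ((‖∑ i, ∑ k, conj (U.1 i j) * U.1 k j * C0 i k‖ ^ 2 : ℝ) : ℂ) =
        ∑ i, ∑ k, ∑ i', ∑ k', (C0 i k * conj (C0 i' k')) *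
          (conj (U.1 i j) * U.1 k j * (U.1 i' j * conj (U.1 k' j))) := fun U => by
      push_cast
      rw [← Complex.conj_mul']
      simp only [map_sum, map_mul, Complex.conj_conj, Finset.sum_mul, Finset.mul_sum]
      refine Finset.sum_congr rfl fun i _ => Finset.sum_congr rfl fun k _ =>
        Finset.sum_congr rfl fun i' _ => Finset.sum_congr rfl fun k' _ => ?_
      ring
    have hint : ∀ i k i' k' : T, Integrable (fun U : unitaryGroup T ℂ =>
        (C0 i k * conj (C0 i' k')) *
          (conj (U.1 i j) * U.1 k j * (U.1 i' j * conj (U.1 k' j)))) (haarUnitary T) :=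
      fun i k i' k' =>
        (integrable_haarUnitary (continuous_colMoment_integrand j i k i' k')).const_mul _
    simp only [hexp]
    rw [integral_finsetSum _ fun i _ => integrable_finsetSum _ fun k _ =>
      integrable_finsetSum _ fun i' _ => integrable_finsetSum _ fun k' _ => hint i k i' k']
    simp only [integral_finsetSum _ fun k _ => integrable_finsetSum _ fun i' _ =>
      integrable_finsetSum _ fun k' _ => hint _ k i' k',
      integral_finsetSum _ fun i' _ => integrable_finsetSum _ fun k' _ => hint _ _ i' k',
      integral_finsetSum _ fun k' _ => hint _ _ _ k', integral_const_mul]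
    have hm : ∀ i k i' k', ∫ U : unitaryGroup T ℂ,
        conj (U.1 i j) * U.1 k j * (U.1 i' j * conj (U.1 k' j)) ∂haarUnitary T =
        (((Fintype.card T : ℝ) * (Fintype.card T + 1))⁻¹ : ℝ) *
          ((if i = k then if i' = k' then 1 else 0 else 0) +
            (if i = i' then if k = k' then 1 else 0 else 0)) := fun i k i' k' => by
      rw [← colMoment_self j]
      refine (colMoment_eq_ite j i k i' k').trans ?_
      simp only [ite_and]
    simp only [hm]
    generalize (((Fintype.card T : ℝ) * (Fintype.card T + 1))⁻¹ : ℝ) = b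
    push_cast
    simp only [mul_add, mul_ite, mul_one, mul_zero, Finset.sum_add_distrib, Finset.sum_ite_eq,
      Finset.sum_ite_irrel, Finset.sum_const_zero, Finset.mem_univ, if_true, ← Finset.sum_mul,
      ← Finset.mul_sum, ← map_sum, htr0]
    simp only [map_zero, mul_zero, zero_mul, zero_add, Complex.mul_conj']
    ring
  rw [Complex.ofReal_injective hval, inv_mul_eq_div]
  gcongr
  nlinarith

end Haar

/-! ### Decoupling of the reference by a random measurement -/

section Measurement

set_option linter.unusedSectionVars false

open Matrix ComplexConjugate

variable {T B R : Type*} [Fintype T] [Fintype B] [Fintype R]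

theorem traceLeft_ketBra_apply (v : B × R → ℂ) (r r' : R) :
    traceLeft (ketBra v) r r' = ∑ b, v (b, r) * conj (v (b, r')) := by
  simp [traceLeft, ketBra, vecMulVec]

theorem trace_traceLeft_ketBra (v : B × R → ℂ) : trace (traceLeft (ketBra v)) = normSq v := by
  simp only [trace, diag_apply, traceLeft_ketBra_apply, Complex.mul_conj', normSq,
    Fintype.sum_prod_type, Complex.ofReal_sum, Complex.ofReal_pow]
  exact Finset.sum_comm

theorem reducedR_eq_sum (Φ : T × B × R → ℂ) :
    reducedR Φ = ∑ t, traceLeft (ketBra fun y => Φ (t, y)) := by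
  ext r r'
  rw [Matrix.sum_apply]
  simp only [reducedR, traceLeft, ketBra, vecMulVec, of_apply,
    Pi.star_apply, RCLike.star_def]
  exact Finset.sum_comm

theorem sum_normSq_slice (Φ : T × B × R → ℂ) : ∑ t, normSq (fun y => Φ (t, y)) = normSq Φ := by
  simp only [normSq, Fintype.sum_prod_type]

theorem normSq_eq_zero_iff {X : Type*} [Fintype X] {v : X → ℂ} : normSq v = 0 ↔ v = 0 := by
  rw [normSq, Finset.sum_eq_zero_iff_of_nonneg fun _ _ => by positivity, funext_iff]
  simp

variable [DecidableEq R]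

/-- Absorbing the probability removes the division by it; an outcome of probability zero has a
vanishing collapsed vector, so both sides are zero. -/
theorem outcomeProb_mul_traceNorm (Φ : T × B × R → ℂ) (e : T → ℂ) (ρ : Matrix R R ℂ) :
    outcomeProb Φ e * traceNorm (postState Φ e - ρ) =
      traceNorm (traceLeft (ketBra (collapse Φ e)) - (outcomeProb Φ e : ℂ) • ρ) := by
  rw [← traceNorm_smul (c := outcomeProb Φ e) (normSq_nonneg _), smul_sub]
  congr 2
  rw [postState, smul_smul]
  by_cases h : outcomeProb Φ e = 0
  · have h0 : collapse Φ e = 0 := normSq_eq_zero_iff.mp h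
    have : traceLeft (ketBra (0 : B × R → ℂ)) = 0 := by
      ext r r'; simp [traceLeft_ketBra_apply]
    rw [h0, this, smul_zero]
  · rw [← Complex.ofReal_mul, mul_inv_cancel₀ h, Complex.ofReal_one, one_smul]

theorem traceNorm_ofReal_smul_le (c : ℝ) (M : Matrix R R ℂ) :
    traceNorm ((c : ℂ) • M) ≤ |c| * traceNorm M := by
  rcases le_total 0 c with h | h
  · rw [traceNorm_smul h, abs_of_nonneg h]
  · rw [← traceNorm_neg, ← neg_smul, ← Complex.ofReal_neg, traceNorm_smul (neg_nonneg.mpr h),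
      abs_of_nonpos h]

theorem traceNorm_reducedR_le (Φ : T × B × R → ℂ) : traceNorm (reducedR Φ) ≤ normSq Φ := by
  rw [reducedR_eq_sum, ← sum_normSq_slice]
  exact (traceNorm_sum_le _ _).trans (Finset.sum_le_sum fun t _ => traceNorm_traceLeft_le _)

theorem trace_reducedR (Φ : T × B × R → ℂ) : trace (reducedR Φ) = normSq Φ := by
  rw [reducedR_eq_sum, trace_sum, ← sum_normSq_slice]
  simp [trace_traceLeft_ketBra]

theorem sum_traceNorm_traceLeft_sub_le {ι : Type*} [Fintype ι] (v w : ι → B × R → ℂ) :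
    ∑ i, traceNorm (traceLeft (ketBra (v i)) - traceLeft (ketBra (w i))) ≤
      √(∑ i, normSq (v i - w i)) * (√(∑ i, normSq (v i)) + √(∑ i, normSq (w i))) := by
  have h := fun u : ι → B × R → ℂ =>
    Real.sum_mul_le_sqrt_mul_sqrt Finset.univ (fun i => √(normSq (v i - w i))) fun i => √(normSq (u i))
  simp only [Real.sq_sqrt (normSq_nonneg _)] at h
  refine (Finset.sum_le_sum fun i _ => traceNorm_traceLeft_sub_le (v i) (w i)).trans ?_
  simp only [mul_add, Finset.sum_add_distrib]
  exact add_le_add (h v) (h w)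

theorem traceNorm_reducedR_sub_le (Φ Φ' : T × B × R → ℂ) :
    traceNorm (reducedR Φ - reducedR Φ') ≤
      √(normSq (Φ - Φ')) * (√(normSq Φ) + √(normSq Φ')) := by
  rw [reducedR_eq_sum, reducedR_eq_sum, ← Finset.sum_sub_distrib]
  refine (traceNorm_sum_le _ _).trans ((sum_traceNorm_traceLeft_sub_le _ _).trans (le_of_eq ?_))
  rw [sum_normSq_slice, sum_normSq_slice, ← sum_normSq_slice (Φ - Φ')]
  rfl

variable [DecidableEq T]

/-- For each fixed coordinate on `B ⊗ R` the collapsed amplitudes are `U†` applied to a slice of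
`Φ`, so this is Parseval's identity. -/
theorem sum_normSq_collapse (Φ : T × B × R → ℂ) (U : unitaryGroup T ℂ) :
    ∑ j, normSq (collapse Φ fun i => U.1 i j) = normSq Φ := by
  have h : ∀ j y, collapse Φ (fun i => U.1 i j) y = (U.1ᴴ *ᵥ fun t => Φ (t, y)) j := fun j y => rfl
  have hU : U.1ᴴᴴ * U.1ᴴ = 1 := by
    rw [conjTranspose_conjTranspose]; exact mem_unitaryGroup_iff.mp U.2
  have h2 : ∀ y, normSq (U.1ᴴ *ᵥ fun t => Φ (t, y)) = normSq fun t => Φ (t, y) := fun y =>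
    normSq_mulVec_of_isometry hU _
  simp only [normSq] at h2
  simp only [normSq, h]
  rw [Finset.sum_comm, Finset.sum_congr rfl fun y _ => h2 y, Finset.sum_comm,
    ← Fintype.sum_prod_type']

theorem collapse_sub (Φ Φ' : T × B × R → ℂ) (e : T → ℂ) :
    collapse (Φ - Φ') e = collapse Φ e - collapse Φ' e := by
  ext y; simp [collapse, mul_sub]

/-- Each entry is a quadratic form in the measured vector, to which the variance bound applies. -/
theorem traceLeft_ketBra_collapse_apply (Φ : T × B × R → ℂ) (e : T → ℂ) (r r' : R) :
    traceLeft (ketBra (collapse Φ e)) r r' =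
      ∑ i, ∑ k, conj (e i) * e k * ∑ b, Φ (i, b, r) * conj (Φ (k, b, r')) := by
  simp only [traceLeft_ketBra_apply, collapse, map_sum, map_mul, RCLike.star_def,
    Complex.conj_conj, Finset.sum_mul_sum]
  simp only [Finset.mul_sum]
  rw [Finset.sum_comm]
  refine Finset.sum_congr rfl fun i _ => ?_
  rw [Finset.sum_comm]
  refine Finset.sum_congr rfl fun k _ => Finset.sum_congr rfl fun b _ => ?_
  ring

theorem continuous_traceLeft_ketBra_collapse (Φ : T × B × R → ℂ) (j : T) :
    Continuous fun U : unitaryGroup T ℂ =>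
      traceLeft (ketBra (collapse Φ fun i => U.1 i j)) := by
  refine continuous_matrix fun r r' => ?_
  simp only [traceLeft_ketBra_collapse_apply]
  exact continuous_finsetSum _ fun i _ => continuous_finsetSum _ fun k _ =>
    ((Complex.continuous_conj.comp (continuous_unitaryGroup_entry i j)).mul
      (continuous_unitaryGroup_entry k j)).mul continuous_const

theorem continuous_sum_traceNorm (Φ : T × B × R → ℂ) :
    Continuous fun U : unitaryGroup T ℂ => ∑ j,
      traceNorm (traceLeft (ketBra (collapse Φ fun i => U.1 i j)) -
        (outcomeProb Φ (fun i => U.1 i j) : ℂ) • reducedR Φ) := by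
  refine continuous_finsetSum _ fun j _ => continuous_traceNorm.comp
    ((continuous_traceLeft_ketBra_collapse Φ j).sub (Continuous.smul (f := fun U : unitaryGroup T ℂ =>
      (outcomeProb Φ (fun i => U.1 i j) : ℂ)) ?_ continuous_const))
  simp only [outcomeProb, ← trace_traceLeft_ketBra]
  exact (continuous_traceLeft_ketBra_collapse Φ j).matrix_trace

/-- A random measurement outcome of a state with small purity of the complementary system decouples
the reference system. -/
theorem integral_traceNorm_collapse_sub_le (Φ : T × B × R → ℂ) (S : Finset R)
    (hS : ∀ t b, ∀ r ∉ S, Φ (t, b, r) = 0) {κ : ℝ} (hκ : 0 < κ)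
    (hpur : ∑ r, ∑ r', ∑ i, ∑ k, ‖∑ b, Φ (i, b, r) * conj (Φ (k, b, r'))‖ ^ 2 ≤ κ) (j : T) :
    ∫ U : unitaryGroup T ℂ, traceNorm (traceLeft (ketBra (collapse Φ fun i => U.1 i j)) -
      (((Fintype.card T : ℝ)⁻¹ : ℝ) : ℂ) • reducedR Φ) ∂haarUnitary T ≤
      √(S.card : ℝ) * √κ * (Fintype.card T : ℝ)⁻¹ := by
  have hd : (0 : ℝ) < Fintype.card T := by exact_mod_cast Fintype.card_pos_iff.mpr ⟨j⟩
  set d : ℝ := (Fintype.card T : ℝ) with hdd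
  set X : unitaryGroup T ℂ → Matrix R R ℂ := fun U =>
    traceLeft (ketBra (collapse Φ fun i => U.1 i j)) - ((d⁻¹ : ℝ) : ℂ) • reducedR Φ with hX
  set C : R → R → Matrix T T ℂ := fun r r' => of fun i k => ∑ b, Φ (i, b, r) * conj (Φ (k, b, r'))
    with hC
  have hXc : Continuous X := (continuous_traceLeft_ketBra_collapse Φ j).sub continuous_const
  have hent : ∀ U r r', X U r r' = ∑ i, ∑ k, conj (U.1 i j) * U.1 k j * C r r' i k -
      (Fintype.card T : ℂ)⁻¹ * trace (C r r') := by
    intro U r r'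
    have h1 : reducedR Φ r r' = trace (C r r') := by
      rw [reducedR_eq_sum, Matrix.sum_apply]
      simp only [traceLeft_ketBra_apply]
      rfl
    simp only [hX, Matrix.sub_apply, Matrix.smul_apply, smul_eq_mul, h1,
      traceLeft_ketBra_collapse_apply]
    simp [hC, hdd]
  have hXS : ∀ U, ∀ r, ∀ r' ∉ S, X U r r' = 0 := by
    intro U r r' hr'
    have : C r r' = 0 := by
      ext i k
      simp [hC, hS k _ r' hr']
    rw [hent, this]; simp
  have hentc : ∀ r r', Continuous fun U => ‖X U r r'‖ ^ 2 := fun r r' =>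
    (hXc.matrix_elem r r').norm.pow 2
  have hF : ∫ U, ∑ r, ∑ r', ‖X U r r'‖ ^ 2 ∂haarUnitary T ≤ κ / d ^ 2 := by
    rw [integral_finsetSum _ fun r _ => integrable_finsetSum _ fun r' _ =>
      integrable_haarUnitary (hentc r r')]
    simp only [integral_finsetSum _ fun r' _ => integrable_haarUnitary (hentc _ r')]
    refine le_trans (Finset.sum_le_sum fun r _ => Finset.sum_le_sum fun r' _ => ?_)
      (?_ : ∑ r, ∑ r', (∑ i, ∑ k, ‖C r r' i k‖ ^ 2) / d ^ 2 ≤ _)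
    · simp only [hent]
      exact integral_norm_quadForm_sub_sq_le (C r r') j
    · simp only [← Finset.sum_div]
      exact div_le_div_of_nonneg_right hpur (by positivity)
  set c : ℝ := √κ / d with hc
  have hcpos : 0 < c := div_pos (Real.sqrt_pos.mpr hκ) hd
  have hc2 : c ^ 2 = κ / d ^ 2 := by rw [hc, div_pow, Real.sq_sqrt hκ.le]
  -- The inequality `√F ≤ F / (2c) + c / 2` replaces Jensen's; it is tight at `c = √κ / d`, the
  -- bound on the root mean square of the deviation.
  have hpt : ∀ U, traceNorm (X U) ≤
      √(S.card : ℝ) * ((∑ r, ∑ r', ‖X U r r'‖ ^ 2) / (2 * c) + c / 2) := by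
    intro U
    refine (traceNorm_le_sqrt_card_mul S (hXS U)).trans ?_
    gcongr
    have h0 : 0 ≤ ∑ r, ∑ r', ‖X U r r'‖ ^ 2 := by positivity
    set F := ∑ r, ∑ r', ‖X U r r'‖ ^ 2
    have h1 : F / (2 * c) + c / 2 - √F = (√F - c) ^ 2 / (2 * c) := by
      rw [sub_sq, Real.sq_sqrt h0]; field_simp; ring
    have h2 : 0 ≤ (√F - c) ^ 2 / (2 * c) := by positivity
    linarith
  have hint : Integrable (fun U => ∑ r, ∑ r', ‖X U r r'‖ ^ 2) (haarUnitary T) :=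
    integrable_finsetSum _ fun r _ => integrable_finsetSum _ fun r' _ =>
      integrable_haarUnitary (hentc r r')
  calc ∫ U, traceNorm (X U) ∂haarUnitary T
      ≤ ∫ U, √(S.card : ℝ) * ((∑ r, ∑ r', ‖X U r r'‖ ^ 2) / (2 * c) + c / 2) ∂haarUnitary T :=
        integral_mono (integrable_haarUnitary (continuous_traceNorm.comp hXc))
          (((hint.div_const _).add (integrable_const _)).const_mul _) hpt
    _ = √(S.card : ℝ) * ((∫ U, ∑ r, ∑ r', ‖X U r r'‖ ^ 2 ∂haarUnitary T) / (2 * c) + c / 2) := by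
        rw [integral_const_mul, integral_add (hint.div_const _) (integrable_const _),
          integral_div]
        simp
    _ ≤ √(S.card : ℝ) * (c ^ 2 / (2 * c) + c / 2) := by
        rw [hc2]; gcongr
    _ = √(S.card : ℝ) * √κ * d⁻¹ := by
        have : c ^ 2 / (2 * c) + c / 2 = c := by field_simp; ring
        rw [this, hc]; ring

/-- Purity and support are controlled only for the nearby vector `Φ'`, while the measured state is
`Φ`; the distance between them enters linearly. -/
theorem integral_sum_traceNorm_le (Φ Φ' : T × B × R → ℂ) (hΦ : normSq Φ = 1)
    (hΦ' : normSq Φ' ≤ 1) (S : Finset R) (hS : ∀ t b, ∀ r ∉ S, Φ' (t, b, r) = 0)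
    {κ : ℝ} (hκ : 0 < κ)
    (hpur : ∑ r, ∑ r', ∑ i, ∑ k, ‖∑ b, Φ' (i, b, r) * conj (Φ' (k, b, r'))‖ ^ 2 ≤ κ) :
    ∫ U : unitaryGroup T ℂ, ∑ j,
      traceNorm (traceLeft (ketBra (collapse Φ fun i => U.1 i j)) -
        (outcomeProb Φ (fun i => U.1 i j) : ℂ) • reducedR Φ) ∂haarUnitary T ≤
      8 * √(normSq (Φ - Φ')) + 2 * (√(S.card : ℝ) * √κ) := by
  set η := √(normSq (Φ - Φ')) with hη
  have hη0 : 0 ≤ η := Real.sqrt_nonneg _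
  set d : ℝ := (Fintype.card T : ℝ) with hdd
  set σ : (T × B × R → ℂ) → unitaryGroup T ℂ → T → Matrix R R ℂ := fun Φ U j =>
    traceLeft (ketBra (collapse Φ fun i => U.1 i j)) with hσ
  set c : ℂ := ((d⁻¹ : ℝ) : ℂ) with hc
  have hdinv : 0 ≤ d⁻¹ := by positivity
  have hsum1 : ∑ _j : T, d⁻¹ ≤ 1 := by
    rw [Finset.sum_const, Finset.card_univ, nsmul_eq_mul, ← hdd]
    exact mul_inv_le_one
  have hs1 : √(normSq Φ) + √(normSq Φ') ≤ 2 := by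
    rw [hΦ, Real.sqrt_one]
    have := Real.sqrt_le_one.mpr hΦ'
    linarith
  have hρ : traceNorm (reducedR Φ' - reducedR Φ) ≤ 2 * η := by
    rw [traceNorm_sub_comm]
    refine (traceNorm_reducedR_sub_le Φ Φ').trans ?_
    rw [mul_comm 2]; gcongr
  have hσsum : ∀ U, ∑ j, traceNorm (σ Φ U j - σ Φ' U j) ≤ 2 * η := fun U => by
    refine (sum_traceNorm_traceLeft_sub_le _ _).trans ?_
    simp only [← collapse_sub, sum_normSq_collapse]
    rw [mul_comm 2]; gcongr
  -- Replacing the random probability by `1 / d` costs a factor two: their difference is the trace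
  -- of `σ - ρ / d`, hence bounded by its trace norm.
  have hstep : ∀ U j, traceNorm (σ Φ U j - (outcomeProb Φ (fun i => U.1 i j) : ℂ) • reducedR Φ) ≤
      2 * traceNorm (σ Φ U j - c • reducedR Φ) := fun U j => by
    set p := outcomeProb Φ (fun i => U.1 i j)
    have h1 : σ Φ U j - (p : ℂ) • reducedR Φ =
        (σ Φ U j - c • reducedR Φ) + ((d⁻¹ - p : ℝ) : ℂ) • reducedR Φ := by
      rw [Complex.ofReal_sub, ← hc]; module
    have h2 : |d⁻¹ - p| ≤ traceNorm (σ Φ U j - c • reducedR Φ) := by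
      refine le_trans (le_of_eq ?_) (abs_re_trace_le_traceNorm _)
      rw [trace_sub, trace_smul, trace_reducedR, hσ, trace_traceLeft_ketBra, hΦ, abs_sub_comm]
      simp [p, outcomeProb, hc]
    have h3 := traceNorm_ofReal_smul_le (d⁻¹ - p) (reducedR Φ)
    have h4 : traceNorm (reducedR Φ) ≤ 1 := hΦ ▸ traceNorm_reducedR_le Φ
    rw [h1]
    refine (traceNorm_add_le _ _).trans ?_
    nlinarith [abs_nonneg (d⁻¹ - p)]
  have hstep2 : ∀ U j, traceNorm (σ Φ U j - c • reducedR Φ) ≤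
      traceNorm (σ Φ U j - σ Φ' U j) + traceNorm (σ Φ' U j - c • reducedR Φ') +
        d⁻¹ * (2 * η) := fun U j => by
    have h1 := traceNorm_sub_le (σ Φ U j) (σ Φ' U j) (c • reducedR Φ)
    have h2 := traceNorm_sub_le (σ Φ' U j) (c • reducedR Φ') (c • reducedR Φ)
    rw [← smul_sub, hc, traceNorm_smul hdinv] at h2
    have h3 := mul_le_mul_of_nonneg_left hρ hdinv
    linarith
  -- The exchange of `Φ` for `Φ'` costs `2η` in the collapsed states and `2η` in the reduced state;
  -- the factor two above makes this `8η`.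
  have hpt : ∀ U, ∑ j, traceNorm (σ Φ U j -
      (outcomeProb Φ (fun i => U.1 i j) : ℂ) • reducedR Φ) ≤
      8 * η + 2 * ∑ j, traceNorm (σ Φ' U j - c • reducedR Φ') := fun U => by
    refine (Finset.sum_le_sum fun j _ => (hstep U j).trans
      (mul_le_mul_of_nonneg_left (hstep2 U j) zero_le_two)).trans ?_
    rw [← Finset.mul_sum, Finset.sum_add_distrib, Finset.sum_add_distrib, ← Finset.sum_mul]
    have h1 := hσsum U
    have h2 := mul_le_mul_of_nonneg_right hsum1 (by positivity : 0 ≤ 2 * η)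
    linarith
  have hcont : ∀ j, Continuous fun U => traceNorm (σ Φ' U j - c • reducedR Φ') := fun j =>
    continuous_traceNorm.comp ((continuous_traceLeft_ketBra_collapse Φ' j).sub continuous_const)
  have hint : Integrable (fun U => ∑ j, traceNorm (σ Φ' U j - c • reducedR Φ'))
      (haarUnitary T) := integrable_finsetSum _ fun j _ => integrable_haarUnitary (hcont j)
  calc _ ≤ ∫ U, (8 * η + 2 * ∑ j, traceNorm (σ Φ' U j - c • reducedR Φ')) ∂haarUnitary T :=
        integral_mono (integrable_haarUnitary (continuous_sum_traceNorm Φ))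
          ((integrable_const _).add (hint.const_mul _)) hpt
    _ = 8 * η + 2 * ∑ j, ∫ U, traceNorm (σ Φ' U j - c • reducedR Φ') ∂haarUnitary T := by
        rw [integral_add (integrable_const _) (hint.const_mul _),
          integral_const_mul 2, integral_finsetSum _ fun j _ => integrable_haarUnitary (hcont j)]
        simp
    _ ≤ 8 * η + 2 * ∑ _j : T, √(S.card : ℝ) * √κ * d⁻¹ := by
        gcongr with j
        exact integral_traceNorm_collapse_sub_le Φ' S hS hκ hpur j
    _ ≤ _ := by
        rw [← Finset.mul_sum]
        have := mul_le_mul_of_nonneg_left hsum1 (by positivity : 0 ≤ √(S.card : ℝ) * √κ)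
        linarith

end Measurement

/-! ### Typical sequences: cardinality, collision probability, Chebyshev -/

section Typicality

variable {X : Type*} [Fintype X]

theorem sum_pi_fin_succ {M : Type*} [AddCommMonoid M] (n : ℕ) (f : (Fin (n + 1) → X) → M) :
    ∑ i, f i = ∑ x, ∑ i : Fin n → X, f (Fin.cons x i) := by
  rw [← Fintype.sum_prod_type', ← (Fin.consEquiv fun _ => X).sum_comp]
  rfl

theorem sum_prod_pi_eq_one {p : X → ℝ} (hp : ∑ x, p x = 1) (n : ℕ) :
    ∑ i : Fin n → X, ∏ k, p (i k) = 1 := by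
  induction n with
  | zero => simp
  | succ n ih =>
    simp only [sum_pi_fin_succ, Fin.prod_univ_succ, Fin.cons_zero, Fin.cons_succ, ← Finset.mul_sum,
      ih, mul_one, hp]

/-- The variance of a sum of independent identically distributed centered variables. -/
theorem sum_prod_pi_mul_sum_sq {p h : X → ℝ} (hp : ∑ x, p x = 1) (hh : ∑ x, p x * h x = 0)
    (n : ℕ) : ∑ i : Fin n → X, (∏ k, p (i k)) * (∑ k, h (i k)) ^ 2 = n * ∑ x, p x * h x ^ 2 := by
  induction n with
  | zero => simp
  | succ n ih =>
    simp only [sum_pi_fin_succ, Fin.prod_univ_succ, Fin.sum_univ_succ, Fin.cons_zero,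
      Fin.cons_succ]
    -- The middle summand is the covariance of the new variable with the old sum; it vanishes
    -- because `h` is centered.
    have hexp : ∀ x (i : Fin n → X), p x * (∏ k, p (i k)) * (h x + ∑ k, h (i k)) ^ 2 =
        p x * h x ^ 2 * (∏ k, p (i k)) + p x * h x * (2 * ((∏ k, p (i k)) * ∑ k, h (i k))) +
          p x * ((∏ k, p (i k)) * (∑ k, h (i k)) ^ 2) := fun x i => by ring
    simp only [hexp, Finset.sum_add_distrib, ← Finset.mul_sum, ih, sum_prod_pi_eq_one hp,
      ← Finset.sum_mul, hp, hh]
    push_cast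
    ring

variable [DecidableEq X] {ρ : Matrix X X ℂ} (hρ : ρ.IsHermitian)

theorem mem_typicalSet {n : ℕ} {δ : ℝ} {i : Fin n → X} : i ∈ typicalSet hρ n δ ↔
    0 < seqProb hρ i ∧ |-Real.logb 2 (seqProb hρ i) - n * entropy hρ| ≤ n * δ := by
  simp [typicalSet]

theorem typicalSet_mono {δ δ' : ℝ} (h : δ ≤ δ') (n : ℕ) :
    typicalSet hρ n δ ⊆ typicalSet hρ n δ' := fun i hi => by
  rw [mem_typicalSet] at hi ⊢
  exact ⟨hi.1, hi.2.trans (by gcongr)⟩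

theorem seqProb_le_of_mem {n : ℕ} {δ : ℝ} {i : Fin n → X} (hi : i ∈ typicalSet hρ n δ) :
    seqProb hρ i ≤ 2 ^ (-(n * (entropy hρ - δ))) := by
  rw [mem_typicalSet] at hi
  rw [← Real.logb_le_iff_le_rpow one_lt_two hi.1]
  linarith [neg_abs_le (-Real.logb 2 (seqProb hρ i) - n * entropy hρ)]

theorem le_seqProb_of_mem {n : ℕ} {δ : ℝ} {i : Fin n → X} (hi : i ∈ typicalSet hρ n δ) :
    2 ^ (-(n * (entropy hρ + δ))) ≤ seqProb hρ i := by
  rw [mem_typicalSet] at hi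
  rw [← Real.le_logb_iff_rpow_le one_lt_two hi.1]
  linarith [le_abs_self (-Real.logb 2 (seqProb hρ i) - n * entropy hρ)]

theorem seqProb_nonneg (h0 : ∀ x, 0 ≤ hρ.eigenvalues x) {n : ℕ} (i : Fin n → X) :
    0 ≤ seqProb hρ i :=
  Finset.prod_nonneg fun k _ => h0 (i k)

theorem sum_seqProb_le_one (h0 : ∀ x, 0 ≤ hρ.eigenvalues x)
    (h1 : ∑ x, hρ.eigenvalues x = 1) {n : ℕ} (s : Finset (Fin n → X)) : ∑ i ∈ s, seqProb hρ i ≤ 1 := by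
  rw [← sum_prod_pi_eq_one h1 n]
  exact Finset.sum_le_sum_of_subset_of_nonneg (Finset.subset_univ s) fun i _ _ =>
    seqProb_nonneg hρ h0 i

/-- Every typical sequence has at least the probability `2^{-n(S + δ)}`, and the total is at most
one. -/
theorem card_typicalSet_le (h0 : ∀ x, 0 ≤ hρ.eigenvalues x)
    (h1 : ∑ x, hρ.eigenvalues x = 1) (n : ℕ) (δ : ℝ) :
    ((typicalSet hρ n δ).card : ℝ) ≤ 2 ^ (n * (entropy hρ + δ)) := by
  have h := (Finset.sum_le_sum fun i hi => le_seqProb_of_mem hρ hi).trans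
    (sum_seqProb_le_one hρ h0 h1 (typicalSet hρ n δ))
  rw [Finset.sum_const, nsmul_eq_mul, Real.rpow_neg zero_le_two,
    mul_inv_le_iff₀ (by positivity)] at h
  linarith

theorem sum_seqProb_sq_le (h0 : ∀ x, 0 ≤ hρ.eigenvalues x)
    (h1 : ∑ x, hρ.eigenvalues x = 1) (n : ℕ) (δ : ℝ) :
    ∑ i ∈ typicalSet hρ n δ, seqProb hρ i ^ 2 ≤ 2 ^ (-(n * (entropy hρ - δ))) := by
  calc ∑ i ∈ typicalSet hρ n δ, seqProb hρ i ^ 2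
      ≤ ∑ i ∈ typicalSet hρ n δ, 2 ^ (-(n * (entropy hρ - δ))) * seqProb hρ i :=
        Finset.sum_le_sum fun i hi => by
          rw [sq]
          exact mul_le_mul_of_nonneg_right (seqProb_le_of_mem hρ hi) (seqProb_nonneg hρ h0 i)
    _ ≤ _ := by
        rw [← Finset.mul_sum]
        exact mul_le_of_le_one_right (by positivity) (sum_seqProb_le_one hρ h0 h1 _)

/-- Chebyshev's inequality for the typical set. -/
theorem sum_seqProb_compl_typicalSet_le (h0 : ∀ x, 0 ≤ hρ.eigenvalues x)
    (h1 : ∑ x, hρ.eigenvalues x = 1) {n : ℕ} (hn : 0 < n) {δ : ℝ} (hδ : 0 < δ) :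
    ∑ i ∈ (typicalSet hρ n δ)ᶜ, seqProb hρ i ≤
      (∑ x, hρ.eigenvalues x * (-Real.logb 2 (hρ.eigenvalues x) - entropy hρ) ^ 2) /
        (n * δ ^ 2) := by
  -- Here `Real.logb 2 0 = 0`; the value at a zero eigenvalue is immaterial, as its weight is zero.
  set h : X → ℝ := fun x => -Real.logb 2 (hρ.eigenvalues x) - entropy hρ with hh
  have hn' : (0 : ℝ) < n := by exact_mod_cast hn
  have hcent : ∑ x, hρ.eigenvalues x * h x = 0 := by
    simp only [hh, mul_sub, Finset.sum_sub_distrib, ← Finset.sum_mul, h1, one_mul]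
    rw [entropy]; simp
  have hpt : ∀ i ∈ (typicalSet hρ n δ)ᶜ,
      seqProb hρ i ≤ seqProb hρ i * (∑ k, h (i k)) ^ 2 / (n * δ) ^ 2 := by
    intro i hi
    rcases (seqProb_nonneg hρ h0 i).eq_or_lt with hz | hpos
    · simp [← hz]
    · rw [Finset.mem_compl, mem_typicalSet, not_and] at hi
      have hi' := hi hpos
      have hsum : -Real.logb 2 (seqProb hρ i) - n * entropy hρ = ∑ k, h (i k) := by
        have hne : ∀ k ∈ Finset.univ, hρ.eigenvalues (i k) ≠ 0 :=
          Finset.prod_ne_zero_iff.mp hpos.ne'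
        rw [seqProb, Real.logb_prod _ _ hne]
        simp [hh, Finset.sum_sub_distrib]
      rw [hsum, not_le] at hi'
      rw [le_div_iff₀ (by positivity)]
      refine mul_le_mul_of_nonneg_left ?_ hpos.le
      rw [← sq_abs (∑ k, h (i k))]
      gcongr
  calc ∑ i ∈ (typicalSet hρ n δ)ᶜ, seqProb hρ i
      ≤ ∑ i ∈ (typicalSet hρ n δ)ᶜ, seqProb hρ i * (∑ k, h (i k)) ^ 2 / (n * δ) ^ 2 :=
        Finset.sum_le_sum hpt
    _ ≤ ∑ i, seqProb hρ i * (∑ k, h (i k)) ^ 2 / (n * δ) ^ 2 :=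
        Finset.sum_le_sum_of_subset_of_nonneg (Finset.subset_univ _) fun i _ _ =>
          div_nonneg (mul_nonneg (seqProb_nonneg hρ h0 i) (sq_nonneg _)) (sq_nonneg _)
    _ = _ := by
        have := sum_prod_pi_mul_sum_sq h1 hcent n
        rw [← Finset.sum_div]
        simp only [seqProb]
        rw [this]
        field_simp
        rfl

theorem eventually_sum_seqProb_compl_typicalSet_le (h0 : ∀ x, 0 ≤ hρ.eigenvalues x)
    (h1 : ∑ x, hρ.eigenvalues x = 1) {δ : ℝ} (hδ : 0 < δ) {τ : ℝ} (hτ : 0 < τ) :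
    ∀ᶠ n : ℕ in atTop, ∑ i ∈ (typicalSet hρ n δ)ᶜ, seqProb hρ i ≤ τ := by
  set V := ∑ x, hρ.eigenvalues x * (-Real.logb 2 (hρ.eigenvalues x) - entropy hρ) ^ 2
  have hlim : Tendsto (fun n : ℕ => V / (n * δ ^ 2)) atTop (nhds 0) :=
    (tendsto_natCast_atTop_atTop.atTop_mul_const (by positivity)).const_div_atTop V
  filter_upwards [hlim.eventually (gt_mem_nhds hτ), eventually_gt_atTop 0] with n hn hn0
  exact (sum_seqProb_compl_typicalSet_le hρ h0 h1 hn0 hδ).trans hn.le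

end Typicality

/-! ### Passage to the eigenbases of the reduced states -/

section Rotation

open Matrix ComplexConjugate

set_option linter.unusedSectionVars false

variable {X Y : Type*} [Fintype X] [Fintype Y] [DecidableEq X] [DecidableEq Y]

theorem ketBra_mulVec (K : Matrix X X ℂ) (v : X → ℂ) : ketBra (K *ᵥ v) = K * ketBra v * Kᴴ := by
  rw [ketBra, ketBra, star_mulVec, mul_vecMulVec, vecMulVec_mul]

theorem trace_mul_traceRight (W : Matrix X X ℂ) (M : Matrix (X × Y) (X × Y) ℂ) :
    trace (W * traceRight M) = trace ((W ⊗ₖ (1 : Matrix Y Y ℂ)) * M) := by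
  simp only [trace, diag_apply, mul_apply, traceRight, of_apply, kroneckerMap_apply,
    Fintype.sum_prod_type, one_apply, mul_ite, ite_mul, mul_one, mul_zero, zero_mul,
    Finset.mul_sum, Finset.sum_ite_eq, Finset.mem_univ, if_true]
  exact Finset.sum_congr rfl fun _ _ => Finset.sum_comm

/-- Tested against all `W`: by cyclicity of the trace the factors on the traced system meet as `K† K
= 1`. -/
theorem traceLeft_kronecker_conj {K : Matrix X X ℂ} (hK : Kᴴ * K = 1) (L : Matrix Y Y ℂ)
    (M : Matrix (X × Y) (X × Y) ℂ) :
    traceLeft ((K ⊗ₖ L) * M * (K ⊗ₖ L)ᴴ) = L * traceLeft M * Lᴴ := by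
  rw [ext_iff_trace_mul_left]
  intro W
  rw [trace_mul_traceLeft, ← Matrix.mul_assoc, trace_mul_comm, ← Matrix.mul_assoc W,
    trace_mul_comm _ Lᴴ, ← Matrix.mul_assoc W, ← Matrix.mul_assoc Lᴴ, trace_mul_traceLeft,
    conjTranspose_kronecker, ← Matrix.mul_assoc, ← Matrix.mul_assoc, ← mul_kronecker_mul,
    ← mul_kronecker_mul, Matrix.mul_one, hK, Matrix.mul_assoc Lᴴ]

theorem traceRight_kronecker_conj (K : Matrix X X ℂ) {L : Matrix Y Y ℂ} (hL : Lᴴ * L = 1)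
    (M : Matrix (X × Y) (X × Y) ℂ) :
    traceRight ((K ⊗ₖ L) * M * (K ⊗ₖ L)ᴴ) = K * traceRight M * Kᴴ := by
  rw [ext_iff_trace_mul_left]
  intro W
  rw [trace_mul_traceRight, ← Matrix.mul_assoc, trace_mul_comm, ← Matrix.mul_assoc W,
    trace_mul_comm _ Kᴴ, ← Matrix.mul_assoc W, ← Matrix.mul_assoc Kᴴ, trace_mul_traceRight,
    conjTranspose_kronecker, ← Matrix.mul_assoc, ← Matrix.mul_assoc, ← mul_kronecker_mul,
    ← mul_kronecker_mul, Matrix.mul_one, hL, Matrix.mul_assoc Kᴴ]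

theorem kronecker_isometry {K : Matrix X X ℂ} (hK : Kᴴ * K = 1) {L : Matrix Y Y ℂ}
    (hL : Lᴴ * L = 1) : (K ⊗ₖ L)ᴴ * (K ⊗ₖ L) = 1 := by
  rw [conjTranspose_kronecker, ← mul_kronecker_mul, hK, hL, one_kronecker_one]

theorem traceLeft_ketBra_kronecker_mulVec {K : Matrix X X ℂ} (hK : Kᴴ * K = 1)
    (L : Matrix Y Y ℂ) (v : X × Y → ℂ) :
    traceLeft (ketBra ((K ⊗ₖ L) *ᵥ v)) = L * traceLeft (ketBra v) * Lᴴ := by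
  rw [ketBra_mulVec, traceLeft_kronecker_conj hK]

theorem collapse_kronecker_mulVec {A B R : Type*} [Fintype A] [Fintype B] [Fintype R]
    [DecidableEq A] {K : Matrix A A ℂ}
    (hK : Kᴴ * K = 1) (L : Matrix (B × R) (B × R) ℂ) (Φ : A × B × R → ℂ) (e : A → ℂ) :
    collapse ((K ⊗ₖ L) *ᵥ Φ) (K *ᵥ e) = L *ᵥ collapse Φ e := by
  have he : star (K *ᵥ e) ᵥ* K = star e := by rw [star_mulVec, vecMul_vecMul, hK, vecMul_one]
  ext y
  simp only [collapse, mulVec, dotProduct, Fintype.sum_prod_type (α₁ := A), kroneckerMap_apply]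
  have he' : ∀ a', ∑ a, star (∑ i, K a i * e i) * K a a' = star (e a') := fun a' =>
    congrFun he a'
  simp only [← he', Finset.mul_sum, Finset.sum_mul]
  rw [Finset.sum_comm]
  rw [Finset.sum_comm (s := (Finset.univ : Finset (B × R)))]
  refine Finset.sum_congr rfl fun a' _ => ?_
  rw [Finset.sum_comm]
  refine Finset.sum_congr rfl fun y' _ => Finset.sum_congr rfl fun a _ => ?_
  ring

section Reduced

variable {A B R : Type*} [Fintype A] [Fintype B] [Fintype R]
  [DecidableEq A] [DecidableEq B] [DecidableEq R]

theorem reducedA_kronecker_mulVec (K : Matrix A A ℂ) {L : Matrix B B ℂ} (hL : Lᴴ * L = 1)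
    {N : Matrix R R ℂ} (hN : Nᴴ * N = 1) (ψ : A × B × R → ℂ) :
    reducedA ((K ⊗ₖ (L ⊗ₖ N)) *ᵥ ψ) = K * reducedA ψ * Kᴴ := by
  rw [reducedA, ketBra_mulVec, traceRight_kronecker_conj _ (kronecker_isometry hL hN), reducedA]

theorem reducedB_kronecker_mulVec {K : Matrix A A ℂ} (hK : Kᴴ * K = 1) (L : Matrix B B ℂ)
    {N : Matrix R R ℂ} (hN : Nᴴ * N = 1) (ψ : A × B × R → ℂ) :
    reducedB ((K ⊗ₖ (L ⊗ₖ N)) *ᵥ ψ) = L * reducedB ψ * Lᴴ := by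
  rw [reducedB, ketBra_mulVec, traceLeft_kronecker_conj hK, traceRight_kronecker_conj _ hN,
    reducedB]

theorem reducedR_kronecker_mulVec {K : Matrix A A ℂ} (hK : Kᴴ * K = 1) {L : Matrix B B ℂ}
    (hL : Lᴴ * L = 1) (N : Matrix R R ℂ) (ψ : A × B × R → ℂ) :
    reducedR ((K ⊗ₖ (L ⊗ₖ N)) *ᵥ ψ) = N * reducedR ψ * Nᴴ := by
  rw [reducedR, ketBra_mulVec, traceLeft_kronecker_conj hK, traceLeft_kronecker_conj hL, reducedR]

theorem reducedA_apply (ψ : A × B × R → ℂ) (a a' : A) :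
    reducedA ψ a a' = ∑ b, ∑ r, ψ (a, b, r) * conj (ψ (a', b, r)) := by
  simp [reducedA, traceRight, ketBra, vecMulVec, Fintype.sum_prod_type]

theorem reducedB_apply (ψ : A × B × R → ℂ) (b b' : B) :
    reducedB ψ b b' = ∑ a, ∑ r, ψ (a, b, r) * conj (ψ (a, b', r)) := by
  simp only [reducedB, traceRight, traceLeft, ketBra, vecMulVec, of_apply, Pi.star_apply,
    RCLike.star_def]
  exact Finset.sum_comm

theorem reducedR_apply (ψ : A × B × R → ℂ) (r r' : R) :
    reducedR ψ r r' = ∑ a, ∑ b, ψ (a, b, r) * conj (ψ (a, b, r')) := by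
  simp only [reducedR, traceLeft, ketBra, vecMulVec, of_apply, Pi.star_apply,
    RCLike.star_def]
  exact Finset.sum_comm

end Reduced

/-! ### Tensor powers -/

/-- The tensor power `V^{⊗n}` of a matrix. -/
def tensorPow (V : Matrix X X ℂ) (n : ℕ) : Matrix (Fin n → X) (Fin n → X) ℂ :=
  of fun x i => ∏ k, V (x k) (i k)

theorem sum_prod_pi {n : ℕ} (f : Fin n → X → ℂ) :
    ∑ i : Fin n → X, ∏ k, f k (i k) = ∏ k, ∑ x, f k x := by
  rw [Finset.prod_univ_sum, Fintype.piFinset_univ]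

theorem sum_sum_prod_pi {n : ℕ} (f : Fin n → X → Y → ℂ) :
    ∑ i : Fin n → X, ∑ j : Fin n → Y, ∏ k, f k (i k) (j k) = ∏ k, ∑ x, ∑ y, f k x y := by
  simp only [sum_prod_pi]
  exact sum_prod_pi fun k x => ∑ y, f k x y

theorem tensorPow_mul (V W : Matrix X X ℂ) (n : ℕ) :
    tensorPow V n * tensorPow W n = tensorPow (V * W) n := by
  ext x i
  simp only [mul_apply, tensorPow, of_apply, ← Finset.prod_mul_distrib]
  exact sum_prod_pi fun k y => V (x k) y * W y (i k)

theorem tensorPow_diagonal (d : X → ℂ) (n : ℕ) :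
    tensorPow (diagonal d) n = diagonal fun i => ∏ k, d (i k) := by
  ext x i
  by_cases h : x = i
  · subst h; simp [tensorPow]
  · rw [diagonal_apply_ne _ h]
    obtain ⟨k, hk⟩ := Function.ne_iff.mp h
    exact Finset.prod_eq_zero (Finset.mem_univ k) (diagonal_apply_ne _ hk)

theorem tensorPow_isometry {V : Matrix X X ℂ} (hV : Vᴴ * V = 1) (n : ℕ) :
    (tensorPow V n)ᴴ * tensorPow V n = 1 := by
  have h : (tensorPow V n)ᴴ = tensorPow Vᴴ n := by
    ext x i; simp [tensorPow]
  rw [h, tensorPow_mul, hV, ← diagonal_one, tensorPow_diagonal]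
  simp

section Eigenbasis

variable {ρ : Matrix X X ℂ} (hρ : ρ.IsHermitian)

/-- The unitary matrix whose columns are the eigenvectors of `ρ`. -/
noncomputable def eigenMatrix : Matrix X X ℂ := hρ.eigenvectorUnitary.1

theorem eigenMatrix_isometry : (eigenMatrix hρ)ᴴ * eigenMatrix hρ = 1 :=
  Unitary.coe_star_mul_self hρ.eigenvectorUnitary

theorem eigenMatrix_isometry' : eigenMatrix hρ * (eigenMatrix hρ)ᴴ = 1 :=
  Unitary.coe_mul_star_self hρ.eigenvectorUnitary

theorem eigenMatrix_conj : (eigenMatrix hρ)ᴴ * ρ * eigenMatrix hρ =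
    diagonal fun x => (hρ.eigenvalues x : ℂ) := by
  have h : ρ = eigenMatrix hρ * (diagonal fun x => (hρ.eigenvalues x : ℂ)) * (eigenMatrix hρ)ᴴ :=
    hρ.spectral_theorem
  have hV := eigenMatrix_isometry hρ
  generalize eigenMatrix hρ = V at h hV ⊢
  rw [← Matrix.one_mul (diagonal _), ← hV, ← Matrix.mul_one (_ * diagonal _), ← hV]
  nth_rewrite 1 [h]
  simp only [Matrix.mul_assoc]

theorem seqVec_eq (n : ℕ) (i x : Fin n → X) :
    seqVec hρ i x = tensorPow (eigenMatrix hρ) n x i := by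
  simp only [seqVec, tensorPow, of_apply, eigenMatrix, IsHermitian.eigenvectorUnitary_apply]

open Classical in
-- In the eigenbasis the typical projector is the indicator of the typical set.
theorem typicalProj_mul_tensorPow (n : ℕ) (δ : ℝ) :
    typicalProj hρ n δ * tensorPow (eigenMatrix hρ) n =
      tensorPow (eigenMatrix hρ) n *
        diagonal fun i => if i ∈ typicalSet hρ n δ then 1 else 0 := by
  set V := tensorPow (eigenMatrix hρ) n with hV
  have hiso : Vᴴ * V = 1 := tensorPow_isometry (eigenMatrix_isometry hρ) n
  ext x l
  have h : ∀ i, (ketBra (seqVec hρ i) * V) x l = V x i * (1 : Matrix _ _ ℂ) i l := fun i => by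
    rw [ketBra, vecMulVec_mul, ← hiso]
    simp only [vecMulVec_apply, seqVec_eq, ← hV, vecMul, dotProduct, mul_apply,
      conjTranspose_apply, Pi.star_apply]
  rw [typicalProj, Finset.sum_mul, Matrix.sum_apply, mul_diagonal]
  simp [h, one_apply]

end Eigenbasis

variable {A B R : Type*} [Fintype A] [Fintype B] [Fintype R]
  [DecidableEq A] [DecidableEq B] [DecidableEq R]

theorem copies_kronecker_mulVec (K : Matrix A A ℂ) (L : Matrix B B ℂ) (N : Matrix R R ℂ)
    (ψ : A × B × R → ℂ) (n : ℕ) :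
    copies ((K ⊗ₖ (L ⊗ₖ N)) *ᵥ ψ) n =
      (tensorPow K n ⊗ₖ (tensorPow L n ⊗ₖ tensorPow N n)) *ᵥ copies ψ n := by
  ext ⟨a, b, r⟩
  simp only [copies, mulVec, dotProduct, Fintype.sum_prod_type, kroneckerMap_apply, tensorPow,
    of_apply, ← Finset.prod_mul_distrib]
  rw [← sum_prod_pi fun k a' => ∑ b', ∑ r', K (a k) a' * (L (b k) b' * N (r k) r') * ψ (a', b', r')]
  refine Finset.sum_congr rfl fun a' _ => ?_
  exact (sum_sum_prod_pi fun k b' r' =>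
    K (a k) (a' k) * (L (b k) b' * N (r k) r') * ψ (a' k, b', r')).symm

theorem reducedA_copies (ψ : A × B × R → ℂ) (n : ℕ) :
    reducedA (copies ψ n) = tensorPow (reducedA ψ) n := by
  ext a a'
  simp only [reducedA_apply, tensorPow, of_apply, copies, map_prod, ← Finset.prod_mul_distrib]
  exact sum_sum_prod_pi fun k b r => ψ (a k, b, r) * conj (ψ (a' k, b, r))

theorem reducedB_copies (ψ : A × B × R → ℂ) (n : ℕ) :
    reducedB (copies ψ n) = tensorPow (reducedB ψ) n := by
  ext b b'
  simp only [reducedB_apply, tensorPow, of_apply, copies, map_prod, ← Finset.prod_mul_distrib]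
  exact sum_sum_prod_pi fun k a r => ψ (a, b k, r) * conj (ψ (a, b' k, r))

theorem reducedR_copies (ψ : A × B × R → ℂ) (n : ℕ) :
    reducedR (copies ψ n) = tensorPow (reducedR ψ) n := by
  ext r r'
  simp only [reducedR_apply, tensorPow, of_apply, copies, map_prod, ← Finset.prod_mul_distrib]
  exact sum_sum_prod_pi fun k a b => ψ (a, b, r k) * conj (ψ (a, b, r' k))

/-- The vector `ψ` in coordinates with respect to the eigenbases of its reduced states. -/
noncomputable def rotated (ψ : A × B × R → ℂ) : A × B × R → ℂ :=
  ((eigenMatrix (isHermitian_reducedA ψ))ᴴ ⊗ₖ ((eigenMatrix (isHermitian_reducedB ψ))ᴴ ⊗ₖ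
    (eigenMatrix (isHermitian_reducedR ψ))ᴴ)) *ᵥ ψ

theorem conjTranspose_eigenMatrix_isometry {ρ : Matrix X X ℂ} (hρ : ρ.IsHermitian) :
    (eigenMatrix hρ)ᴴᴴ * (eigenMatrix hρ)ᴴ = 1 := by
  rw [conjTranspose_conjTranspose, eigenMatrix_isometry']

theorem eq_mulVec_rotated (ψ : A × B × R → ℂ) :
    ψ = (eigenMatrix (isHermitian_reducedA ψ) ⊗ₖ (eigenMatrix (isHermitian_reducedB ψ) ⊗ₖ
      eigenMatrix (isHermitian_reducedR ψ))) *ᵥ rotated ψ := by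
  rw [rotated, mulVec_mulVec, ← mul_kronecker_mul, ← mul_kronecker_mul, eigenMatrix_isometry',
    eigenMatrix_isometry', eigenMatrix_isometry', one_kronecker_one, one_kronecker_one, one_mulVec]

theorem reducedA_rotated (ψ : A × B × R → ℂ) : reducedA (rotated ψ) =
    diagonal fun x => ((isHermitian_reducedA ψ).eigenvalues x : ℂ) := by
  rw [rotated, reducedA_kronecker_mulVec _ (conjTranspose_eigenMatrix_isometry _)
    (conjTranspose_eigenMatrix_isometry _), conjTranspose_conjTranspose, eigenMatrix_conj]

theorem reducedB_rotated (ψ : A × B × R → ℂ) : reducedB (rotated ψ) =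
    diagonal fun x => ((isHermitian_reducedB ψ).eigenvalues x : ℂ) := by
  rw [rotated, reducedB_kronecker_mulVec (conjTranspose_eigenMatrix_isometry _) _
    (conjTranspose_eigenMatrix_isometry _), conjTranspose_conjTranspose, eigenMatrix_conj]

theorem reducedR_rotated (ψ : A × B × R → ℂ) : reducedR (rotated ψ) =
    diagonal fun x => ((isHermitian_reducedR ψ).eigenvalues x : ℂ) := by
  rw [rotated, reducedR_kronecker_mulVec (conjTranspose_eigenMatrix_isometry _)
    (conjTranspose_eigenMatrix_isometry _), conjTranspose_conjTranspose, eigenMatrix_conj]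

theorem normSq_rotated (ψ : A × B × R → ℂ) : normSq (rotated ψ) = normSq ψ :=
  normSq_mulVec_of_isometry (kronecker_isometry (conjTranspose_eigenMatrix_isometry _)
    (kronecker_isometry (conjTranspose_eigenMatrix_isometry _)
      (conjTranspose_eigenMatrix_isometry _))) ψ

theorem diagonal_seqProb {ρ : Matrix X X ℂ} (hρ : ρ.IsHermitian) (n : ℕ) :
    tensorPow (diagonal fun x => (hρ.eigenvalues x : ℂ)) n =
      diagonal fun i => (seqProb hρ i : ℂ) := by
  rw [tensorPow_diagonal]; simp [seqProb]

open Classical in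
/-- The restriction of a vector to a box of coordinates. -/
def restrictBox (SA : Finset A) (SB : Finset B) (SR : Finset R) (φ : A × B × R → ℂ) :
    A × B × R → ℂ :=
  fun x => if x.1 ∈ SA ∧ x.2.1 ∈ SB ∧ x.2.2 ∈ SR then φ x else 0

/-- The typical part of `ψ^{⊗n}` in the coordinates of the eigenbases. -/
noncomputable def rotatedTypicalPart (ψ : A × B × R → ℂ) (n : ℕ) (δA δB δR : ℝ) :
    (Fin n → A) × (Fin n → B) × (Fin n → R) → ℂ :=
  restrictBox (typicalSet (isHermitian_reducedA ψ) n δA) (typicalSet (isHermitian_reducedB ψ) n δB)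
    (typicalSet (isHermitian_reducedR ψ) n δR) (copies (rotated ψ) n)

theorem typicalPart_eq_mulVec (ψ : A × B × R → ℂ) (n : ℕ) (δ : ℝ) :
    typicalPart ψ n δ = (tensorPow (eigenMatrix (isHermitian_reducedA ψ)) n ⊗ₖ
      (tensorPow (eigenMatrix (isHermitian_reducedB ψ)) n ⊗ₖ
        tensorPow (eigenMatrix (isHermitian_reducedR ψ)) n)) *ᵥ rotatedTypicalPart ψ n δ δ δ := by
  classical
  have h : copies ψ n = (tensorPow (eigenMatrix (isHermitian_reducedA ψ)) n ⊗ₖ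
      (tensorPow (eigenMatrix (isHermitian_reducedB ψ)) n ⊗ₖ
        tensorPow (eigenMatrix (isHermitian_reducedR ψ)) n)) *ᵥ copies (rotated ψ) n := by
    rw [← copies_kronecker_mulVec, ← eq_mulVec_rotated]
  rw [typicalPart, h, mulVec_mulVec, ← mul_kronecker_mul, ← mul_kronecker_mul,
    typicalProj_mul_tensorPow, typicalProj_mul_tensorPow, typicalProj_mul_tensorPow,
    mul_kronecker_mul, mul_kronecker_mul, ← mulVec_mulVec, diagonal_kronecker_diagonal,
    diagonal_kronecker_diagonal]
  congr 1
  ext ⟨a, b, r⟩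
  rw [mulVec_diagonal]
  simp only [rotatedTypicalPart, restrictBox]
  by_cases ha : a ∈ typicalSet (isHermitian_reducedA ψ) n δ <;>
  by_cases hb : b ∈ typicalSet (isHermitian_reducedB ψ) n δ <;>
  by_cases hr : r ∈ typicalSet (isHermitian_reducedR ψ) n δ <;> simp [ha, hb, hr]

theorem normSq_typicalPart (ψ : A × B × R → ℂ) (n : ℕ) (δ : ℝ) :
    normSq (typicalPart ψ n δ) = normSq (rotatedTypicalPart ψ n δ δ δ) := by
  rw [typicalPart_eq_mulVec]
  exact normSq_mulVec_of_isometry (kronecker_isometry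
    (tensorPow_isometry (eigenMatrix_isometry _) n) (kronecker_isometry
    (tensorPow_isometry (eigenMatrix_isometry _) n)
    (tensorPow_isometry (eigenMatrix_isometry _) n))) _

/-- The normalized typical part with the first coordinate restricted to typical sequences. -/
noncomputable def typicalCoords (ψ : A × B × R → ℂ) (n : ℕ) (δ δ' : ℝ) :
    typicalSet (isHermitian_reducedA ψ) n δ × (Fin n → B) × (Fin n → R) → ℂ :=
  fun x => ((√(normSq (typicalPart ψ n δ)))⁻¹ : ℝ) * rotatedTypicalPart ψ n δ δ' δ' (x.1.1, x.2)

/-- The local unitaries on `B` and `R` leave probabilities and trace norms unchanged. On `A` only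
typical coordinates carry amplitude, so the index set can be cut to them; `U` then acts on the whole
first factor, as the decoupling bound requires. -/
theorem disturbance_eq (ψ : A × B × R → ℂ) (n : ℕ) (δ : ℝ)
    (U : unitaryGroup (typicalSet (isHermitian_reducedA ψ) n δ) ℂ) :
    disturbance ψ n δ U = ∑ j,
      traceNorm (traceLeft (ketBra (collapse (typicalCoords ψ n δ δ) fun i => U.1 i j)) -
        (outcomeProb (typicalCoords ψ n δ δ) (fun i => U.1 i j) : ℂ) •
          reducedR (typicalCoords ψ n δ δ)) := by
  set K := tensorPow (eigenMatrix (isHermitian_reducedA ψ)) n with hKdef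
  set L := tensorPow (eigenMatrix (isHermitian_reducedB ψ)) n
  set N := tensorPow (eigenMatrix (isHermitian_reducedR ψ)) n
  have hK : Kᴴ * K = 1 := tensorPow_isometry (eigenMatrix_isometry _) n
  have hL : Lᴴ * L = 1 := tensorPow_isometry (eigenMatrix_isometry _) n
  have hN : Nᴴ * N = 1 := tensorPow_isometry (eigenMatrix_isometry _) n
  set c : ℂ := (((√(normSq (typicalPart ψ n δ)))⁻¹ : ℝ) : ℂ) with hc
  set Ψ := c • rotatedTypicalPart ψ n δ δ δ with hΨ
  have hΨ0 : ∀ a ∉ typicalSet (isHermitian_reducedA ψ) n δ, ∀ y, Ψ (a, y) = 0 := fun a ha y => by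
    simp [hΨ, rotatedTypicalPart, restrictBox, ha]
  have hstate : typicalState ψ n δ = (K ⊗ₖ (L ⊗ₖ N)) *ᵥ Ψ := by
    rw [hΨ, mulVec_smul, ← typicalPart_eq_mulVec]
    rfl
  have hred : reducedR (typicalState ψ n δ) = N * reducedR (typicalCoords ψ n δ δ) * Nᴴ := by
    rw [hstate, reducedR_kronecker_mulVec hK hL]
    congr 2
    rw [reducedR_eq_sum, reducedR_eq_sum,
      ← Finset.sum_subset (Finset.subset_univ (typicalSet (isHermitian_reducedA ψ) n δ))
        fun a _ ha => ?_,
      ← Finset.sum_coe_sort (typicalSet (isHermitian_reducedA ψ) n δ)]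
    · rfl
    · have : (fun y => Ψ (a, y)) = 0 := funext fun y => hΨ0 a ha y
      rw [this]
      ext r r'; simp [traceLeft_ketBra_apply]
  have hcol : ∀ j, collapse (typicalState ψ n δ) (rotatedBasis ψ n δ U j) =
      (L ⊗ₖ N) *ᵥ collapse (typicalCoords ψ n δ δ) fun i => U.1 i j := by
    intro j
    classical
    -- The column `j` of `U`, extended by zero to atypical sequences.
    set e : (Fin n → A) → ℂ := fun a =>
      if h : a ∈ typicalSet (isHermitian_reducedA ψ) n δ then U.1 ⟨a, h⟩ j else 0 with he
    have hbasis : rotatedBasis ψ n δ U j = K *ᵥ e := by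
      ext x
      simp only [rotatedBasis, mulVec, dotProduct, seqVec_eq]
      rw [← Finset.sum_subset (Finset.subset_univ (typicalSet (isHermitian_reducedA ψ) n δ))
        fun a _ ha => by simp [he, ha],
        ← Finset.sum_coe_sort (typicalSet (isHermitian_reducedA ψ) n δ)]
      refine Finset.sum_congr rfl fun i _ => ?_
      simp [he, ← hKdef, mul_comm]
    rw [hbasis, hstate, collapse_kronecker_mulVec hK]
    congr 1
    ext y
    simp only [collapse]
    rw [← Finset.sum_subset (Finset.subset_univ (typicalSet (isHermitian_reducedA ψ) n δ))
        fun a _ ha => by simp [he, ha],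
      ← Finset.sum_coe_sort (typicalSet (isHermitian_reducedA ψ) n δ)]
    refine Finset.sum_congr rfl fun i _ => ?_
    simp only [he, i.2, dif_pos]
    rfl
  rw [disturbance]
  refine Finset.sum_congr rfl fun j _ => ?_
  have hp : outcomeProb (typicalState ψ n δ) (rotatedBasis ψ n δ U j) =
      outcomeProb (typicalCoords ψ n δ δ) fun i => U.1 i j := by
    rw [outcomeProb, hcol, normSq_mulVec_of_isometry (kronecker_isometry hL hN), outcomeProb]
  rw [outcomeProb_mul_traceNorm, hp, hcol, traceLeft_ketBra_kronecker_mulVec hL, hred]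
  refine Eq.trans ?_ (traceNorm_conj hN _)
  congr 1
  simp only [Matrix.mul_sub, Matrix.sub_mul, Matrix.mul_smul, Matrix.smul_mul]

end Rotation

/-! ### Purity, truncation and the final estimate -/

section Assembly

open Matrix ComplexConjugate

set_option linter.unusedSectionVars false

variable {A B R : Type*} [Fintype A] [Fintype B] [Fintype R]
  [DecidableEq A] [DecidableEq B] [DecidableEq R]

theorem re_reducedA_self (φ : A × B × R → ℂ) (a : A) :
    (reducedA φ a a).re = ∑ b, ∑ r, ‖φ (a, b, r)‖ ^ 2 := by
  simp only [reducedA_apply, Complex.mul_conj', Complex.re_sum, ← Complex.ofReal_pow,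
    Complex.ofReal_re]

theorem re_reducedB_self (φ : A × B × R → ℂ) (b : B) :
    (reducedB φ b b).re = ∑ a, ∑ r, ‖φ (a, b, r)‖ ^ 2 := by
  simp only [reducedB_apply, Complex.mul_conj', Complex.re_sum, ← Complex.ofReal_pow,
    Complex.ofReal_re]

theorem re_reducedR_self (φ : A × B × R → ℂ) (r : R) :
    (reducedR φ r r).re = ∑ a, ∑ b, ‖φ (a, b, r)‖ ^ 2 := by
  simp only [reducedR_apply, Complex.mul_conj', Complex.re_sum, ← Complex.ofReal_pow,
    Complex.ofReal_re]

theorem sum_re_reducedA_eq_ite (φ : A × B × R → ℂ) (s : Finset A) :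
    ∑ a ∈ s, (reducedA φ a a).re = ∑ x, if x.1 ∈ s then ‖φ x‖ ^ 2 else 0 := by
  simp only [Fintype.sum_prod_type]
  rw [← Finset.sum_subset (Finset.subset_univ s) fun a _ ha => by simp [ha]]
  exact Finset.sum_congr rfl fun a ha => by simp [ha, re_reducedA_self]

theorem sum_re_reducedB_eq_ite (φ : A × B × R → ℂ) (s : Finset B) :
    ∑ b ∈ s, (reducedB φ b b).re = ∑ x, if x.2.1 ∈ s then ‖φ x‖ ^ 2 else 0 := by
  simp only [Fintype.sum_prod_type]
  rw [Finset.sum_comm, ← Finset.sum_subset (Finset.subset_univ s) fun b _ hb => by simp [hb]]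
  exact Finset.sum_congr rfl fun b hb => by simp [hb, re_reducedB_self]

theorem sum_re_reducedR_eq_ite (φ : A × B × R → ℂ) (s : Finset R) :
    ∑ r ∈ s, (reducedR φ r r).re = ∑ x, if x.2.2 ∈ s then ‖φ x‖ ^ 2 else 0 := by
  simp only [Fintype.sum_prod_type]
  rw [Finset.sum_congr rfl fun a _ => Finset.sum_comm, Finset.sum_comm,
    ← Finset.sum_subset (Finset.subset_univ s) fun r _ hr => by simp [hr]]
  exact Finset.sum_congr rfl fun r hr => by simp [hr, re_reducedR_self]

/-- Union bound: a coordinate outside the box violates at least one of the three constraints. -/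
theorem normSq_le_normSq_restrictBox_add (φ : A × B × R → ℂ) (SA : Finset A) (SB : Finset B)
    (SR : Finset R) : normSq φ ≤ normSq (restrictBox SA SB SR φ) +
      (∑ a ∈ SAᶜ, (reducedA φ a a).re + ∑ b ∈ SBᶜ, (reducedB φ b b).re +
        ∑ r ∈ SRᶜ, (reducedR φ r r).re) := by
  rw [sum_re_reducedA_eq_ite, sum_re_reducedB_eq_ite, sum_re_reducedR_eq_ite, normSq, normSq,
    ← Finset.sum_add_distrib, ← Finset.sum_add_distrib, ← Finset.sum_add_distrib]
  refine Finset.sum_le_sum fun x _ => ?_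
  have h := sq_nonneg ‖φ x‖
  simp only [restrictBox, Finset.mem_compl]
  by_cases ha : x.1 ∈ SA <;> by_cases hb : x.2.1 ∈ SB <;> by_cases hr : x.2.2 ∈ SR <;>
    simp [ha, hb, hr]

theorem normSq_restrictBox_sub_le (φ : A × B × R → ℂ) (SA : Finset A) {SB SB' : Finset B}
    {SR SR' : Finset R} (hB : SB' ⊆ SB) (hR : SR' ⊆ SR) :
    normSq (restrictBox SA SB SR φ - restrictBox SA SB' SR' φ) ≤
      ∑ b ∈ SB'ᶜ, (reducedB φ b b).re + ∑ r ∈ SR'ᶜ, (reducedR φ r r).re := by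
  rw [sum_re_reducedB_eq_ite, sum_re_reducedR_eq_ite, normSq, ← Finset.sum_add_distrib]
  refine Finset.sum_le_sum fun x _ => ?_
  have h := sq_nonneg ‖φ x‖
  simp only [restrictBox, Finset.mem_compl, Pi.sub_apply]
  by_cases hb : x.2.1 ∈ SB' <;> by_cases hr : x.2.2 ∈ SR'
  · simp [hb, hr, hB hb, hR hr]
  all_goals
    simp only [hb, hr, and_false, false_and, if_false, sub_zero, not_true_eq_false,
      not_false_eq_true, if_true]
    split_ifs <;> simp

theorem normSq_restrictBox_le (φ : A × B × R → ℂ) (SA : Finset A) {SB SB' : Finset B}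
    {SR SR' : Finset R} (hB : SB' ⊆ SB) (hR : SR' ⊆ SR) :
    normSq (restrictBox SA SB' SR' φ) ≤ normSq (restrictBox SA SB SR φ) := by
  refine Finset.sum_le_sum fun x _ => ?_
  simp only [restrictBox]
  by_cases h : x.1 ∈ SA ∧ x.2.1 ∈ SB' ∧ x.2.2 ∈ SR'
  · rw [if_pos h, if_pos ⟨h.1, hB h.2.1, hR h.2.2⟩]
  · rw [if_neg h]; simp

theorem sum_norm_sq_eq_trace {X Y : Type*} [Fintype X] [Fintype Y] (M : Matrix X Y ℂ) :
    ((∑ x, ∑ y, ‖M x y‖ ^ 2 : ℝ) : ℂ) = trace (M * Mᴴ) := by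
  simp only [trace, diag_apply, mul_apply, conjTranspose_apply, RCLike.star_def,
    Complex.mul_conj', Complex.ofReal_sum, Complex.ofReal_pow]

/-- The reductions of a pure state to complementary systems have the same purity. -/
theorem sum_norm_sq_eq_purity (φ : A × B × R → ℂ) :
    ∑ r, ∑ r', ∑ i, ∑ k, ‖∑ b, φ (i, b, r) * conj (φ (k, b, r'))‖ ^ 2 =
      ∑ b, ∑ b', ‖reducedB φ b b'‖ ^ 2 := by
  -- With `φ` read as a matrix from `B` to `R ⊗ A`, the two reductions are `M M†` and, up to
  -- transposition, `M† M`, which have equal Hilbert–Schmidt norm.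
  set M : Matrix (R × A) B ℂ := of fun x b => φ (x.2, b, x.1) with hM
  have h1 := sum_norm_sq_eq_trace (M * Mᴴ)
  have h2 := sum_norm_sq_eq_trace (Mᴴ * M)
  have h3 : trace (M * Mᴴ * (M * Mᴴ)ᴴ) = trace (Mᴴ * M * (Mᴴ * M)ᴴ) := by
    rw [conjTranspose_mul, conjTranspose_mul, conjTranspose_conjTranspose, Matrix.mul_assoc,
      trace_mul_comm]
    simp only [Matrix.mul_assoc]
  rw [← h2, ← h1] at h3
  have h4 := Complex.ofReal_injective h3
  simp only [mul_apply, conjTranspose_apply, hM, of_apply, Fintype.sum_prod_type,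
    RCLike.star_def] at h4
  rw [Finset.sum_congr rfl fun r _ => Finset.sum_comm, h4, Finset.sum_comm]
  refine Finset.sum_congr rfl fun b _ => Finset.sum_congr rfl fun b' _ => ?_
  rw [reducedB_apply, Finset.sum_comm]
  simp only [mul_comm]

/-- The cuts on `A` and `R` only delete nonnegative terms and can be dropped. The cut on `B` acts
inside the norm and is kept; after passing to the purity of `B` it selects a block of `reducedB φ`.
-/
theorem sum_norm_sq_restrictBox_le (φ : A × B × R → ℂ) (SA : Finset A) (SB : Finset B)
    (SR : Finset R) :
    ∑ r, ∑ r', ∑ i, ∑ k, ‖∑ b, restrictBox SA SB SR φ (i, b, r) *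
      conj (restrictBox SA SB SR φ (k, b, r'))‖ ^ 2 ≤
      ∑ b ∈ SB, ∑ b' ∈ SB, ‖reducedB φ b b'‖ ^ 2 := by
  have hle : ∑ r, ∑ r', ∑ i, ∑ k, ‖∑ b, restrictBox SA SB SR φ (i, b, r) *
      conj (restrictBox SA SB SR φ (k, b, r'))‖ ^ 2 ≤
      ∑ r, ∑ r', ∑ i, ∑ k, ‖∑ b, restrictBox Finset.univ SB Finset.univ φ (i, b, r) *
        conj (restrictBox Finset.univ SB Finset.univ φ (k, b, r'))‖ ^ 2 := by
    refine Finset.sum_le_sum fun r _ => Finset.sum_le_sum fun r' _ => Finset.sum_le_sum fun i _ =>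
      Finset.sum_le_sum fun k _ => ?_
    by_cases h : (i ∈ SA ∧ r ∈ SR) ∧ k ∈ SA ∧ r' ∈ SR
    · simp [restrictBox, h.1.1, h.1.2, h.2.1, h.2.2]
    · have : ∀ b, restrictBox SA SB SR φ (i, b, r) * conj (restrictBox SA SB SR φ (k, b, r')) = 0 := by
        intro b
        simp only [restrictBox, apply_ite conj, map_zero, mul_ite, ite_mul, zero_mul, mul_zero]
        split_ifs <;> tauto
      simp only [this, Finset.sum_const_zero, norm_zero]
      simp
  refine hle.trans (le_of_eq ?_)
  rw [sum_norm_sq_eq_purity]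
  have hent : ∀ b b', ‖reducedB (restrictBox Finset.univ SB Finset.univ φ) b b'‖ ^ 2 =
      if b ∈ SB then if b' ∈ SB then ‖reducedB φ b b'‖ ^ 2 else 0 else 0 := fun b b' => by
    simp only [reducedB_apply, restrictBox, Finset.mem_univ, true_and, and_true]
    split_ifs <;> simp
  simp only [hent, Finset.sum_ite_irrel, Finset.sum_const_zero, Finset.sum_ite_mem,
    Finset.univ_inter]

/-! ### The eigenvalue distributions -/

variable (ψ : A × B × R → ℂ)

theorem eigenvalues_reducedA_eq (a : A) :
    (isHermitian_reducedA ψ).eigenvalues a = (reducedA (rotated ψ) a a).re := by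
  rw [reducedA_rotated]; simp

theorem eigenvalues_reducedB_eq (b : B) :
    (isHermitian_reducedB ψ).eigenvalues b = (reducedB (rotated ψ) b b).re := by
  rw [reducedB_rotated]; simp

theorem eigenvalues_reducedR_eq (r : R) :
    (isHermitian_reducedR ψ).eigenvalues r = (reducedR (rotated ψ) r r).re := by
  rw [reducedR_rotated]; simp

theorem eigenvalues_reducedA_nonneg (a : A) : 0 ≤ (isHermitian_reducedA ψ).eigenvalues a := by
  rw [eigenvalues_reducedA_eq, re_reducedA_self]; positivity

theorem eigenvalues_reducedB_nonneg (b : B) : 0 ≤ (isHermitian_reducedB ψ).eigenvalues b := by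
  rw [eigenvalues_reducedB_eq, re_reducedB_self]; positivity

theorem eigenvalues_reducedR_nonneg (r : R) : 0 ≤ (isHermitian_reducedR ψ).eigenvalues r := by
  rw [eigenvalues_reducedR_eq, re_reducedR_self]; positivity

theorem sum_eigenvalues_reducedA : ∑ a, (isHermitian_reducedA ψ).eigenvalues a = normSq ψ := by
  simp only [eigenvalues_reducedA_eq]
  rw [sum_re_reducedA_eq_ite, ← normSq_rotated]
  simp [normSq]

theorem sum_eigenvalues_reducedB : ∑ b, (isHermitian_reducedB ψ).eigenvalues b = normSq ψ := by
  simp only [eigenvalues_reducedB_eq]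
  rw [sum_re_reducedB_eq_ite, ← normSq_rotated]
  simp [normSq]

theorem sum_eigenvalues_reducedR : ∑ r, (isHermitian_reducedR ψ).eigenvalues r = normSq ψ := by
  simp only [eigenvalues_reducedR_eq]
  rw [sum_re_reducedR_eq_ite, ← normSq_rotated]
  simp [normSq]

theorem reducedA_copies_rotated (n : ℕ) : reducedA (copies (rotated ψ) n) =
    diagonal fun i => (seqProb (isHermitian_reducedA ψ) i : ℂ) := by
  rw [reducedA_copies, reducedA_rotated, diagonal_seqProb]

theorem reducedB_copies_rotated (n : ℕ) : reducedB (copies (rotated ψ) n) =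
    diagonal fun i => (seqProb (isHermitian_reducedB ψ) i : ℂ) := by
  rw [reducedB_copies, reducedB_rotated, diagonal_seqProb]

theorem reducedR_copies_rotated (n : ℕ) : reducedR (copies (rotated ψ) n) =
    diagonal fun i => (seqProb (isHermitian_reducedR ψ) i : ℂ) := by
  rw [reducedR_copies, reducedR_rotated, diagonal_seqProb]

theorem normSq_copies_rotated (hψ : normSq ψ = 1) (n : ℕ) :
    normSq (copies (rotated ψ) n) = 1 := by
  have h := sum_re_reducedA_eq_ite (copies (rotated ψ) n) Finset.univ
  rw [reducedA_copies_rotated] at h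
  simp only [diagonal_apply_eq, Complex.ofReal_re, Finset.mem_univ, if_true] at h
  rw [normSq, ← h]
  exact sum_prod_pi_eq_one ((sum_eigenvalues_reducedA ψ).trans hψ) n

theorem one_sub_le_normSq_typicalPart (hψ : normSq ψ = 1) (n : ℕ) (δ : ℝ) :
    1 - (∑ i ∈ (typicalSet (isHermitian_reducedA ψ) n δ)ᶜ, seqProb (isHermitian_reducedA ψ) i +
      ∑ i ∈ (typicalSet (isHermitian_reducedB ψ) n δ)ᶜ, seqProb (isHermitian_reducedB ψ) i +
      ∑ i ∈ (typicalSet (isHermitian_reducedR ψ) n δ)ᶜ, seqProb (isHermitian_reducedR ψ) i) ≤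
      normSq (typicalPart ψ n δ) := by
  have h := normSq_le_normSq_restrictBox_add (copies (rotated ψ) n)
    (typicalSet (isHermitian_reducedA ψ) n δ) (typicalSet (isHermitian_reducedB ψ) n δ)
    (typicalSet (isHermitian_reducedR ψ) n δ)
  rw [normSq_copies_rotated ψ hψ, reducedA_copies_rotated, reducedB_copies_rotated,
    reducedR_copies_rotated] at h
  simp only [diagonal_apply_eq, Complex.ofReal_re] at h
  rw [normSq_typicalPart, rotatedTypicalPart]
  linarith

theorem normSq_mul_subtype {Y Z : Type*} [Fintype Y] [Fintype Z] (s : Finset Y)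
    (f : Y × Z → ℂ) (hf : ∀ y ∉ s, ∀ z, f (y, z) = 0) (c : ℝ) :
    normSq (fun x : s × Z => (c : ℂ) * f (x.1.1, x.2)) = c ^ 2 * normSq f := by
  simp only [normSq, Fintype.sum_prod_type, norm_mul, mul_pow, Complex.norm_real,
    Real.norm_eq_abs, sq_abs, ← Finset.mul_sum]
  rw [Finset.sum_coe_sort s fun y => ∑ z, ‖f (y, z)‖ ^ 2,
    Finset.sum_subset (Finset.subset_univ s) fun y _ hy => ?_]
  simp [hf y hy]

theorem rotatedTypicalPart_eq_zero {n : ℕ} {δA δB δR : ℝ} {a : Fin n → A}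
    (ha : a ∉ typicalSet (isHermitian_reducedA ψ) n δA) (y : (Fin n → B) × (Fin n → R)) :
    rotatedTypicalPart ψ n δA δB δR (a, y) = 0 := by
  simp [rotatedTypicalPart, restrictBox, ha]

theorem inv_sqrt_normSq_sq (n : ℕ) (δ : ℝ) :
    ((√(normSq (typicalPart ψ n δ)))⁻¹) ^ 2 = (normSq (typicalPart ψ n δ))⁻¹ := by
  rw [inv_pow, Real.sq_sqrt (normSq_nonneg _)]

theorem normSq_typicalCoords (n : ℕ) (δ δ' : ℝ) : normSq (typicalCoords ψ n δ δ') =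
    (normSq (typicalPart ψ n δ))⁻¹ * normSq (rotatedTypicalPart ψ n δ δ' δ') := by
  rw [← inv_sqrt_normSq_sq]
  exact normSq_mul_subtype _ _ (fun a ha y => rotatedTypicalPart_eq_zero ψ ha y) _

/-- Both vectors carry the normalization belonging to `δ`, so their difference is just the amplitude
removed by the tighter cut on `B` and `R`. -/
theorem normSq_typicalCoords_sub_le (n : ℕ) {δ δ' : ℝ} (h : δ' ≤ δ) :
    normSq (typicalCoords ψ n δ δ - typicalCoords ψ n δ δ') ≤
      (normSq (typicalPart ψ n δ))⁻¹ *
      (∑ i ∈ (typicalSet (isHermitian_reducedB ψ) n δ')ᶜ, seqProb (isHermitian_reducedB ψ) i +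
        ∑ i ∈ (typicalSet (isHermitian_reducedR ψ) n δ')ᶜ, seqProb (isHermitian_reducedR ψ) i) := by
  have h1 : typicalCoords ψ n δ δ - typicalCoords ψ n δ δ' = fun x =>
      (((√(normSq (typicalPart ψ n δ)))⁻¹ : ℝ) : ℂ) *
        (rotatedTypicalPart ψ n δ δ δ - rotatedTypicalPart ψ n δ δ' δ') (x.1.1, x.2) := by
    ext x; simp only [typicalCoords, Pi.sub_apply, mul_sub]
  rw [h1, normSq_mul_subtype _ _ (fun a ha y => ?_), inv_sqrt_normSq_sq]
  · refine mul_le_mul_of_nonneg_left ?_ (inv_nonneg.mpr (normSq_nonneg _))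
    have h2 := normSq_restrictBox_sub_le (copies (rotated ψ) n)
      (typicalSet (isHermitian_reducedA ψ) n δ) (typicalSet_mono (isHermitian_reducedB ψ) h n)
      (typicalSet_mono (isHermitian_reducedR ψ) h n)
    rw [reducedB_copies_rotated, reducedR_copies_rotated] at h2
    simp only [diagonal_apply_eq, Complex.ofReal_re] at h2
    exact h2
  · simp [rotatedTypicalPart_eq_zero ψ ha]

theorem purity_typicalCoords_le (hψ : normSq ψ = 1) (n : ℕ) (δ δ' : ℝ) :
    ∑ r, ∑ r', ∑ i, ∑ k, ‖∑ b, typicalCoords ψ n δ δ' (i, b, r) *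
      conj (typicalCoords ψ n δ δ' (k, b, r'))‖ ^ 2 ≤
      (normSq (typicalPart ψ n δ))⁻¹ ^ 2 *
        2 ^ (-(n * (entropy (isHermitian_reducedB ψ) - δ'))) := by
  set f := rotatedTypicalPart ψ n δ δ' δ' with hf
  set c : ℝ := (√(normSq (typicalPart ψ n δ)))⁻¹ with hc
  have hent : ∀ i k r r', ‖∑ b, typicalCoords ψ n δ δ' (i, b, r) *
      conj (typicalCoords ψ n δ δ' (k, b, r'))‖ ^ 2 =
      (c ^ 2) ^ 2 * ‖∑ b, f (i.1, b, r) * conj (f (k.1, b, r'))‖ ^ 2 := fun i k r r' => by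
    have : ∀ b, typicalCoords ψ n δ δ' (i, b, r) * conj (typicalCoords ψ n δ δ' (k, b, r')) =
        ((c ^ 2 : ℝ) : ℂ) * (f (i.1, b, r) * conj (f (k.1, b, r'))) := fun b => by
      simp only [typicalCoords, ← hc, ← hf, map_mul, Complex.conj_ofReal]
      push_cast; ring
    simp only [this, ← Finset.mul_sum]
    rw [norm_mul, mul_pow, Complex.norm_real, Real.norm_eq_abs, sq_abs]
  simp only [hent, ← Finset.mul_sum]
  rw [hc, inv_sqrt_normSq_sq]
  refine mul_le_mul_of_nonneg_left ?_ (by positivity)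
  have hsub : ∀ g : (Fin n → A) → ℝ, (∀ a, 0 ≤ g a) →
      ∑ i : typicalSet (isHermitian_reducedA ψ) n δ, g i.1 ≤ ∑ a, g a := fun g hg => by
    rw [Finset.sum_coe_sort (typicalSet (isHermitian_reducedA ψ) n δ) g]
    exact Finset.sum_le_sum_of_subset_of_nonneg (Finset.subset_univ _) fun a _ _ => hg a
  calc _ ≤ ∑ r, ∑ r', ∑ i, ∑ k, ‖∑ b, f (i, b, r) * conj (f (k, b, r'))‖ ^ 2 := by
        refine Finset.sum_le_sum fun r _ => Finset.sum_le_sum fun r' _ => ?_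
        refine (Finset.sum_le_sum fun i _ => hsub
          (fun k => ‖∑ b, f (i.1, b, r) * conj (f (k, b, r'))‖ ^ 2) fun k => by positivity).trans ?_
        exact hsub (fun i => ∑ k, ‖∑ b, f (i, b, r) * conj (f (k, b, r'))‖ ^ 2)
          fun i => by positivity
    _ ≤ ∑ b ∈ typicalSet (isHermitian_reducedB ψ) n δ',
        ∑ b' ∈ typicalSet (isHermitian_reducedB ψ) n δ',
          ‖reducedB (copies (rotated ψ) n) b b'‖ ^ 2 := sum_norm_sq_restrictBox_le _ _ _ _
    _ = ∑ b ∈ typicalSet (isHermitian_reducedB ψ) n δ', seqProb (isHermitian_reducedB ψ) b ^ 2 := by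
        refine Finset.sum_congr rfl fun b hb => ?_
        rw [reducedB_copies_rotated, Finset.sum_eq_single_of_mem b hb fun b' _ h => by
          rw [diagonal_apply_ne _ h.symm]; simp]
        simp
    _ ≤ _ := sum_seqProb_sq_le _ (eigenvalues_reducedB_nonneg ψ)
        ((sum_eigenvalues_reducedB ψ).trans hψ) n δ'

theorem integrable_disturbance (n : ℕ) (δ : ℝ) : Integrable (disturbance ψ n δ)
    (haarUnitary (typicalSet (isHermitian_reducedA ψ) n δ)) := by
  rw [funext (disturbance_eq ψ n δ)]
  exact integrable_haarUnitary (continuous_sum_traceNorm _)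

theorem integral_disturbance_le (hψ : normSq ψ = 1) (n : ℕ) {δ δ' : ℝ} (h : δ' ≤ δ)
    (hN : 1 / 2 ≤ normSq (typicalPart ψ n δ)) {τ : ℝ}
    (hB : ∑ i ∈ (typicalSet (isHermitian_reducedB ψ) n δ')ᶜ,
      seqProb (isHermitian_reducedB ψ) i ≤ τ)
    (hR : ∑ i ∈ (typicalSet (isHermitian_reducedR ψ) n δ')ᶜ,
      seqProb (isHermitian_reducedR ψ) i ≤ τ) :
    ∫ U, disturbance ψ n δ U ∂haarUnitary (typicalSet (isHermitian_reducedA ψ) n δ) ≤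
      16 * √τ + 4 * √(2 ^ (-(n * (entropy (isHermitian_reducedB ψ) -
        entropy (isHermitian_reducedR ψ) - 2 * δ')))) := by
  set N := normSq (typicalPart ψ n δ) with hNdef
  have hNpos : 0 < N := by linarith
  have hNinv : N⁻¹ ≤ 2 := by
    rw [inv_le_comm₀ hNpos two_pos]; linarith
  have hone : normSq (typicalCoords ψ n δ δ) = 1 := by
    rw [normSq_typicalCoords, ← normSq_typicalPart, inv_mul_cancel₀ hNpos.ne']
  have hle : normSq (typicalCoords ψ n δ δ') ≤ 1 := by
    rw [← hone, normSq_typicalCoords, normSq_typicalCoords]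
    exact mul_le_mul_of_nonneg_left (normSq_restrictBox_le _ _ (typicalSet_mono _ h n)
      (typicalSet_mono _ h n)) (inv_nonneg.mpr hNpos.le)
  -- Normalization at most `2` times the two tails `τ`, so the distance is at most `2√τ`, and `8η`
  -- becomes `16√τ`.
  have hdist : normSq (typicalCoords ψ n δ δ - typicalCoords ψ n δ δ') ≤ 2 ^ 2 * τ := by
    refine (normSq_typicalCoords_sub_le ψ n h).trans ?_
    have h0 : 0 ≤ ∑ i ∈ (typicalSet (isHermitian_reducedB ψ) n δ')ᶜ,
          seqProb (isHermitian_reducedB ψ) i +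
        ∑ i ∈ (typicalSet (isHermitian_reducedR ψ) n δ')ᶜ, seqProb (isHermitian_reducedR ψ) i :=
      add_nonneg
        (Finset.sum_nonneg fun i _ => seqProb_nonneg _ (eigenvalues_reducedB_nonneg ψ) i)
        (Finset.sum_nonneg fun i _ => seqProb_nonneg _ (eigenvalues_reducedR_nonneg ψ) i)
    refine (mul_le_mul_of_nonneg_right hNinv h0).trans ?_
    linarith
  set SB := entropy (isHermitian_reducedB ψ)
  set SR := entropy (isHermitian_reducedR ψ)
  have hpur := purity_typicalCoords_le ψ hψ n δ δ'
  have hcard := card_typicalSet_le (isHermitian_reducedR ψ) (eigenvalues_reducedR_nonneg ψ)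
    ((sum_eigenvalues_reducedR ψ).trans hψ) n δ'
  have hmain := integral_sum_traceNorm_le (typicalCoords ψ n δ δ) (typicalCoords ψ n δ δ') hone hle
    (typicalSet (isHermitian_reducedR ψ) n δ')
    (fun t b r hr => by simp [typicalCoords, rotatedTypicalPart, restrictBox, hr])
    (by positivity) hpur
  simp only [disturbance_eq]
  refine hmain.trans (add_le_add ?_ ?_)
  · have := Real.sqrt_le_sqrt hdist
    rw [Real.sqrt_mul (by positivity), Real.sqrt_sq zero_le_two] at this
    linarith
  · rw [← Real.sqrt_mul (Nat.cast_nonneg _)]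
    -- Dimension of the support on `R` times the purity bound; the `2 ^ 2` is the squared
    -- normalization.
    have : ((typicalSet (isHermitian_reducedR ψ) n δ').card : ℝ) *
        (N⁻¹ ^ 2 * 2 ^ (-(n * (SB - δ')))) ≤ 2 ^ 2 * 2 ^ (-(n * (SB - SR - 2 * δ'))) := by
      calc _ ≤ (2 : ℝ) ^ (n * (SR + δ')) * (2 ^ 2 * 2 ^ (-(n * (SB - δ')))) := by gcongr
        _ = 2 ^ 2 * ((2 : ℝ) ^ (n * (SR + δ')) * 2 ^ (-(n * (SB - δ')))) := by ring
        _ = _ := by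
          rw [← Real.rpow_add two_pos]; congr 2; ring
    have h2 := Real.sqrt_le_sqrt this
    rw [Real.sqrt_mul (by positivity : (0 : ℝ) ≤ 2 ^ 2), Real.sqrt_sq zero_le_two] at h2
    linarith

end Assembly

end StateMerging

theorem proposition3 {A B R : Type*} [Fintype A] [Fintype B] [Fintype R]
    [DecidableEq A] [DecidableEq B] [DecidableEq R]
    (ψ : A × B × R → ℂ) (hψ : StateMerging.normSq ψ = 1)
    (hS : StateMerging.entropy (StateMerging.isHermitian_reducedR ψ) <
      StateMerging.entropy (StateMerging.isHermitian_reducedB ψ))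
    (δ : ℝ) (hδ : 0 < δ) (ε : ℝ) (hε : 0 < ε) :
    ∀ᶠ n : ℕ in atTop,
      StateMerging.typicalPart ψ n δ ≠ 0 ∧
      Integrable (StateMerging.disturbance ψ n δ)
        (StateMerging.haarUnitary
          (StateMerging.typicalSet (StateMerging.isHermitian_reducedA ψ) n δ)) ∧
      ∫ U, StateMerging.disturbance ψ n δ U
        ∂StateMerging.haarUnitary
          (StateMerging.typicalSet (StateMerging.isHermitian_reducedA ψ) n δ) ≤ ε := by
  open StateMerging in
  set SB := entropy (isHermitian_reducedB ψ)
  set SR := entropy (isHermitian_reducedR ψ)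
  -- At most `δ`, so that the tighter typical sets are subsets, and small enough that the exponent
  -- `SB - SR - 2 δ'` is at least half the entropy gap.
  set δ' := min δ ((SB - SR) / 4) with hδ'
  have hδ'pos : 0 < δ' := lt_min hδ (by linarith)
  -- Chosen so that `16√τ = ε / 2`; the other half of `ε` is `4 · (ε / 8)`, from the exponentially
  -- small term.
  have hτ : 0 < (ε / 32) ^ 2 := by positivity
  have hA1 := (sum_eigenvalues_reducedA ψ).trans hψ
  have hB1 := (sum_eigenvalues_reducedB ψ).trans hψ
  have hR1 := (sum_eigenvalues_reducedR ψ).trans hψ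
  have hlim : Tendsto (fun n : ℕ => (2 : ℝ) ^ (-(n * (SB - SR - 2 * δ')))) atTop (nhds 0) := by
    have hpos : 0 < SB - SR - 2 * δ' := by
      have := min_le_right δ ((SB - SR) / 4)
      linarith
    exact (tendsto_rpow_atBot_of_base_gt_one 2 one_lt_two).comp
      (tendsto_neg_atTop_atBot.comp (tendsto_natCast_atTop_atTop.atTop_mul_const hpos))
  filter_upwards [
    eventually_sum_seqProb_compl_typicalSet_le _ (eigenvalues_reducedA_nonneg ψ) hA1 hδ
      (by norm_num : (0 : ℝ) < 1 / 6),
    eventually_sum_seqProb_compl_typicalSet_le _ (eigenvalues_reducedB_nonneg ψ) hB1 hδ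
      (by norm_num : (0 : ℝ) < 1 / 6),
    eventually_sum_seqProb_compl_typicalSet_le _ (eigenvalues_reducedR_nonneg ψ) hR1 hδ
      (by norm_num : (0 : ℝ) < 1 / 6),
    eventually_sum_seqProb_compl_typicalSet_le _ (eigenvalues_reducedB_nonneg ψ) hB1 hδ'pos hτ,
    eventually_sum_seqProb_compl_typicalSet_le _ (eigenvalues_reducedR_nonneg ψ) hR1 hδ'pos hτ,
    hlim.eventually (gt_mem_nhds (by positivity : 0 < (ε / 8) ^ 2))]
    with n hA hB hR hB' hR' hn
  -- Three tails of at most `1 / 6` leave at least half of the squared norm.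
  have hN : 1 / 2 ≤ normSq (typicalPart ψ n δ) := by
    have := one_sub_le_normSq_typicalPart ψ hψ n δ
    linarith
  refine ⟨fun h => ?_, integrable_disturbance ψ n δ, ?_⟩
  · rw [h] at hN
    norm_num [normSq] at hN
  · refine (integral_disturbance_le ψ hψ n (min_le_left _ _) hN hB' hR').trans ?_
    have h1 : √((ε / 32) ^ 2) = ε / 32 := Real.sqrt_sq (by positivity)
    have h2 := Real.sqrt_le_sqrt hn.le
    rw [Real.sqrt_sq (by positivity)] at h2
    rw [h1]
    linarith
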